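/- Let $\mathsf G$ be a discrete group which is rigidly symmetric: for every $C^*$-algebra $\mathcal B$ the Banach $^*$-algebra $\ell^1(\mathsf G;\mathcal B)\cong\ell^1(\mathsf G)\widehat\otimes\mathcal B$, with product $(f\star g)(x)=\sum_{y}f(y)g(y^{-1}x)$ and involution $f^\star(x)=f(x^{-1})^*$, is symmetric, i.e. every element of the form $f^\star\star f$ has spectrum contained in $[0,\infty)$. Let $(\alpha,\omega)$ be a twisted action of $\mathsf G$ on a unital $C^*$-algebra $\mathcal A$: maps $\alpha:\mathsf G\to\mathrm{Aut}(\mathcal A)$ and $\omega:\mathsf G\times\mathsf G\to\mathcal U(\mathcal A)$ (the unitary group of $\mathcal A$) such that, for all $x,y,z\in\mathsf G$ and $a\in\mathcal A$ (with $\mathsf e$ the unit of $\mathsf G$), $\alpha_x(\alpha_y(a))=\omega(x,y)\,\alpha_{xy}(a)\,\omega(x,y)^*$, $\ \omega(x,y)\,\omega(xy,z)=\alpha_x(\omega(y,z))\,\omega(x,yz)$ and $\omega(x,\mathsf e)=1=\omega(\mathsf e,x)$. Let $\ell^1_{\alpha,\omega}(\mathsf G;\mathcal A)$ be the Banach $^*$-algebra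 of absolutely summable functions $f:\mathsf G\to\mathcal A$ with $$(f\diamond g)(x)=\sum_{y\in\mathsf G}f(y)\,\alpha_y[g(y^{-1}x)]\,\omega(y,y^{-1}x),\qquad f^{\diamond}(x)=\omega(x,x^{-1})^*\,\alpha_x[f(x^{-1})]^*,$$ and let $\mathcal A\rtimes_\alpha^\omega\mathsf G$ be its enveloping $C^*$-algebra. Let $\mathcal J$ be a closed self-adjoint two-sided ideal of $\mathcal A$ with $\alpha_x(\mathcal J)\subset\mathcal J$ for all $x\in\mathsf G$, and let $\mathcal J\rtimes_\alpha^\omega\mathsf G$ be the corresponding ideal of $\mathcal A\rtimes_\alpha^\omega\mathsf G$, i.e. the closure of the image of $\ell^1_{\alpha,\omega}(\mathsf G;\mathcal J)$. Let $\Pi:\mathcal A\rtimes_\alpha^\omega\mathsf G\to\mathbb B(\mathscr H)$ be a faithful $^*$-representation on a Hilbert space $\mathscr H$ such that $\Pi[\mathcal J\rtimes_\alpha^\omega\mathsf G]=\mathbb K(\mathscr H)$, the ideal of compact operators. Then the $^*$-algebra $\Pi[\ell^1_{\alpha,\omega}(\mathsf G;\mathcal A)]$ is Fredholm inverse closed: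 for every Fredholm operator $T\in\Pi[\ell^1_{\alpha,\omega}(\mathsf G;\mathcal A)]$ (closed range, finite-dimensional $\ker T$ and $\ker T^*$) there exist $S\in\Pi[\ell^1_{\alpha,\omega}(\mathsf G;\mathcal A)]$ and $K,L\in\mathbb K(\mathscr H)$ with $ST=1+K$ and $TS=1+L$. -/

import Mathlib

open scoped ENNReal


universe u v w

noncomputable section

namespace TwistedCrossed

/-! ### Weighted convolution on `ℓ¹(G; A)` -/

section Fibers

/-- The data needed to convolve `A`-valued functions on `G`: products
`a, b ↦ mul x y a b` (of a value at `x` and a value at `y`, giving a value at `x * y`) and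
involutions `a ↦ inv x a` (of a value at `x⁻¹`, giving a value at `x`), subject to the laws
that turn `ℓ¹(G; A)` into a Banach `*`-algebra. Only two instances are used below: the
one of a twisted action (`TwistedAction.fibers`) and the plain one (`plainFibers`). -/
structure FiberStructure (G : Type u) [Group G] (A : Type v) [NormedAddCommGroup A]
    [NormedSpace ℂ A] where
  mul : G → G → A →L[ℂ] A →L[ℂ] A
  inv : G → A →L⋆[ℂ] A
  norm_mul_le : ∀ x y a b, ‖mul x y a b‖ ≤ ‖a‖ * ‖b‖
  mul_assoc : ∀ x y z a b c,
    mul (x * y) z (mul x y a b) c = mul x (y * z) a (mul y z b c)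
  norm_inv : ∀ x a, ‖inv x a‖ = ‖a‖
  inv_inv : ∀ x a, inv x (inv x⁻¹ a) = a
  inv_mul : ∀ x y a b,
    inv (x * y)⁻¹ (mul x y a b) = mul y⁻¹ x⁻¹ (inv y⁻¹ b) (inv x⁻¹ a)

variable {G : Type u} [Group G] {A : Type v} [NormedAddCommGroup A] [NormedSpace ℂ A]

/-- The Banach space `ℓ¹(G; A)`, to be equipped with the convolution and the involution
determined by `S`. -/
def L1 (_S : FiberStructure G A) : Type (max u v) := lp (fun _ : G => A) 1

namespace L1

variable {S : FiberStructure G A}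

instance : NormedAddCommGroup (L1 S) := inferInstanceAs (NormedAddCommGroup (lp (fun _ : G => A) 1))

instance : NormedSpace ℂ (L1 S) := inferInstanceAs (NormedSpace ℂ (lp (fun _ : G => A) 1))

instance [CompleteSpace A] : CompleteSpace (L1 S) :=
  inferInstanceAs (CompleteSpace (lp (fun _ : G => A) 1))

/-- The function underlying an element of `ℓ¹(G; A)`. -/
def toFun (f : L1 S) : G → A := f.1

instance : CoeFun (L1 S) (fun _ => G → A) := ⟨toFun⟩

theorem ext {f g : L1 S} (h : ∀ x, f x = g x) : f = g := lp.ext (funext h)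

@[simp] theorem add_apply (f g : L1 S) (x : G) : (f + g) x = f x + g x := rfl

@[simp] theorem zero_apply (x : G) : (0 : L1 S) x = 0 := rfl

@[simp] theorem smul_apply (c : ℂ) (f : L1 S) (x : G) : (c • f) x = c • f x := rfl

theorem memlp_one_iff {f : G → A} : Memℓp f 1 ↔ Summable fun x => ‖f x‖ := by
  simpa using memℓp_gen_iff (p := 1) (f := f) (by simp)

theorem summable_norm (f : L1 S) : Summable fun x => ‖f x‖ := memlp_one_iff.1 f.2

/-- An absolutely summable function as an element of `ℓ¹(G; A)`. -/
def mk (f : G → A) (hf : Summable fun x => ‖f x‖) : L1 S := ⟨f, memlp_one_iff.2 hf⟩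

@[simp] theorem mk_apply (f : G → A) (hf : Summable fun x => ‖f x‖) (x : G) :
    (mk f hf : L1 S) x = f x := rfl

theorem norm_eq (f : L1 S) : ‖f‖ = ∑' x, ‖f x‖ := by
  have := lp.norm_eq_tsum_rpow (p := 1) (by simp) (show lp (fun _ : G => A) 1 from f)
  simp only [ENNReal.toReal_one, Real.rpow_one, one_div, inv_one] at this
  exact this

theorem norm_apply_le (f : L1 S) (x : G) : ‖f x‖ ≤ ‖f‖ := by
  rw [norm_eq]
  exact (summable_norm f).le_tsum x fun _ _ => norm_nonneg _

theorem summable_prod (f g : L1 S) :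
    Summable fun p : G × G => ‖f p.1‖ * ‖g (p.1⁻¹ * p.2)‖ := by
  have h := (summable_norm f).mul_of_nonneg (summable_norm g)
    (fun _ => norm_nonneg _) (fun _ => norm_nonneg _)
  have := (Equiv.prodShear (Equiv.refl G) fun y : G => Equiv.mulLeft y⁻¹).summable_iff.2 h
  simpa [Function.comp_def] using this

theorem tsum_prod (f g : L1 S) :
    ∑' p : G × G, ‖f p.1‖ * ‖g (p.1⁻¹ * p.2)‖ = ‖f‖ * ‖g‖ := by
  have h := (summable_norm f).mul_of_nonneg (summable_norm g)
    (fun _ => norm_nonneg _) (fun _ => norm_nonneg _)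
  have e := (Equiv.prodShear (Equiv.refl G) fun y : G => Equiv.mulLeft y⁻¹).tsum_eq
    (fun p : G × G => ‖f p.1‖ * ‖g p.2‖)
  rw [norm_eq, norm_eq, (summable_norm f).tsum_mul_tsum (summable_norm g) h, ← e]
  rfl

theorem summable_swap (f g : L1 S) :
    Summable fun p : G × G => ‖f p.2‖ * ‖g (p.2⁻¹ * p.1)‖ :=
  (summable_prod f g).prod_symm

theorem summable_at (f g : L1 S) (x : G) : Summable fun y => ‖f y‖ * ‖g (y⁻¹ * x)‖ :=
  (summable_swap f g).prod_factor x

theorem summable_norm_conv (f g : L1 S) (x : G) :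
    Summable fun y => ‖S.mul y (y⁻¹ * x) (f y) (g (y⁻¹ * x))‖ :=
  (summable_at f g x).of_nonneg_of_le (fun _ => norm_nonneg _)
    fun _ => S.norm_mul_le _ _ _ _

variable [CompleteSpace A]

theorem summable_conv (f g : L1 S) (x : G) :
    Summable fun y => S.mul y (y⁻¹ * x) (f y) (g (y⁻¹ * x)) :=
  (summable_norm_conv f g x).of_norm

theorem norm_conv_le (f g : L1 S) (x : G) :
    ‖∑' y, S.mul y (y⁻¹ * x) (f y) (g (y⁻¹ * x))‖ ≤ ∑' y, ‖f y‖ * ‖g (y⁻¹ * x)‖ :=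
  (norm_tsum_le_tsum_norm (summable_norm_conv f g x)).trans <|
    (summable_norm_conv f g x).tsum_le_tsum (fun _ => S.norm_mul_le _ _ _ _) (summable_at f g x)

theorem summable_norm_tsum (f g : L1 S) :
    Summable fun x => ‖∑' y, S.mul y (y⁻¹ * x) (f y) (g (y⁻¹ * x))‖ :=
  (summable_swap f g).prod.of_nonneg_of_le (fun _ => norm_nonneg _) (norm_conv_le f g)

/-- Convolution: `(f * g)(x) = ∑_y mul y (y⁻¹x) (f y) (g (y⁻¹x))`. -/
instance : Mul (L1 S) :=
  ⟨fun f g => mk (fun x => ∑' y, S.mul y (y⁻¹ * x) (f y) (g (y⁻¹ * x))) (summable_norm_tsum f g)⟩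

theorem mul_apply (f g : L1 S) (x : G) :
    (f * g) x = ∑' y, S.mul y (y⁻¹ * x) (f y) (g (y⁻¹ * x)) := rfl

theorem norm_mul_le' (f g : L1 S) : ‖f * g‖ ≤ ‖f‖ * ‖g‖ := by
  rw [norm_eq, ← tsum_prod]
  have hs := summable_swap f g
  have e : ∑' p : G × G, ‖f p.1‖ * ‖g (p.1⁻¹ * p.2)‖
      = ∑' p : G × G, ‖f p.2‖ * ‖g (p.2⁻¹ * p.1)‖ :=
    ((Equiv.prodComm G G).tsum_eq (fun p : G × G => ‖f p.1‖ * ‖g (p.1⁻¹ * p.2)‖)).symm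
  rw [e, hs.tsum_prod]
  exact (summable_norm (f * g)).tsum_le_tsum (norm_conv_le f g) hs.prod

theorem mul_add' (f g h : L1 S) : f * (g + h) = f * g + f * h := by
  refine ext fun x => ?_
  simp only [mul_apply, add_apply, map_add]
  exact (summable_conv f g x).tsum_add (summable_conv f h x)

theorem add_mul' (f g h : L1 S) : (f + g) * h = f * h + g * h := by
  refine ext fun x => ?_
  simp only [mul_apply, add_apply, map_add, _root_.add_apply]
  exact (summable_conv f h x).tsum_add (summable_conv g h x)

theorem smul_mul' (c : ℂ) (f g : L1 S) : (c • f) * g = c • (f * g) := by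
  refine ext fun x => ?_
  simp only [mul_apply, smul_apply, map_smul, _root_.smul_apply]
  exact tsum_const_smul'' c

theorem mul_smul' (c : ℂ) (f g : L1 S) : f * (c • g) = c • (f * g) := by
  refine ext fun x => ?_
  simp only [mul_apply, smul_apply, map_smul]
  exact tsum_const_smul'' c

theorem summable_triple (f g h : L1 S) (x : G) : Summable fun p : G × G =>
    S.mul p.2 (p.2⁻¹ * x) (S.mul p.1 (p.1⁻¹ * p.2) (f p.1) (g (p.1⁻¹ * p.2)))
      (h (p.2⁻¹ * x)) := by
  refine .of_norm_bounded (g := fun p : G × G => ‖f p.1‖ * ‖g (p.1⁻¹ * p.2)‖ * ‖h‖)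
    ((summable_prod f g).mul_right _) fun p => ?_
  refine (S.norm_mul_le _ _ _ _).trans ?_
  exact mul_le_mul (S.norm_mul_le _ _ _ _) (norm_apply_le h _) (norm_nonneg _) (by positivity)

theorem mul_assoc' (f g h : L1 S) : f * g * h = f * (g * h) := by
  refine ext fun x => ?_
  have hl : ∀ y, S.mul y (y⁻¹ * x) ((f * g) y) (h (y⁻¹ * x)) =
      ∑' z, S.mul y (y⁻¹ * x) (S.mul z (z⁻¹ * y) (f z) (g (z⁻¹ * y))) (h (y⁻¹ * x)) := by
    intro y
    exact ((S.mul y (y⁻¹ * x)).flip (h (y⁻¹ * x))).map_tsum (summable_conv f g y)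
  have hr : ∀ z, S.mul z (z⁻¹ * x) (f z) ((g * h) (z⁻¹ * x)) =
      ∑' y, S.mul y (y⁻¹ * x) (S.mul z (z⁻¹ * y) (f z) (g (z⁻¹ * y))) (h (y⁻¹ * x)) := by
    intro z
    have h1 := (S.mul z (z⁻¹ * x) (f z)).map_tsum (summable_conv g h (z⁻¹ * x))
    refine h1.trans ?_
    rw [← (Equiv.mulLeft z⁻¹).tsum_eq]
    refine tsum_congr fun y => ?_
    have h2 := S.mul_assoc z (z⁻¹ * y) (y⁻¹ * x) (f z) (g (z⁻¹ * y)) (h (y⁻¹ * x))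
    have e1 : (z⁻¹ * y)⁻¹ * (z⁻¹ * x) = y⁻¹ * x := by group
    have e2 : z⁻¹ * y * (y⁻¹ * x) = z⁻¹ * x := by group
    rw [mul_inv_cancel_left, e2] at h2
    simp only [Equiv.coe_mulLeft, e1]
    exact h2.symm
  rw [mul_apply, mul_apply, tsum_congr hl, tsum_congr hr]
  have ht := summable_triple f g h x
  exact ht.tsum_comm

instance : NonUnitalNormedRing (L1 S) :=
  { (inferInstance : NormedAddCommGroup (L1 S)) with
    mul := (· * ·)
    left_distrib := mul_add'
    right_distrib := add_mul'
    zero_mul := fun f => by simpa using smul_mul' 0 (0 : L1 S) f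
    mul_zero := fun f => by simpa using mul_smul' 0 f (0 : L1 S)
    mul_assoc := mul_assoc'
    norm_mul_le := norm_mul_le' }

instance : IsScalarTower ℂ (L1 S) (L1 S) := ⟨smul_mul'⟩

instance : SMulCommClass ℂ (L1 S) (L1 S) := ⟨fun c f g => (mul_smul' c f g).symm⟩

theorem summable_norm_star (f : L1 S) : Summable fun x => ‖S.inv x (f x⁻¹)‖ := by
  simp only [S.norm_inv]
  exact (Equiv.inv G).summable_iff.2 (summable_norm f)

/-- Involution: `f^*(x) = inv x (f x⁻¹)`. -/
instance : Star (L1 S) := ⟨fun f => mk (fun x => S.inv x (f x⁻¹)) (summable_norm_star f)⟩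

theorem star_apply (f : L1 S) (x : G) : (star f) x = S.inv x (f x⁻¹) := rfl

theorem star_mul' (f g : L1 S) : star (f * g) = star g * star f := by
  refine ext fun x => ?_
  rw [star_apply, mul_apply, (S.inv x).map_tsum (summable_conv f g x⁻¹), mul_apply,
    ← (Equiv.mulLeft x).tsum_eq fun z => S.mul z (z⁻¹ * x) (star g z) (star f (z⁻¹ * x))]
  refine tsum_congr fun y => ?_
  have h := S.inv_mul y (y⁻¹ * x⁻¹) (f y) (g (y⁻¹ * x⁻¹))
  have e1 : (y⁻¹ * x⁻¹)⁻¹ = x * y := by group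
  have e2 : (x * y)⁻¹ * x = y⁻¹ := by group
  rw [mul_inv_cancel_left, inv_inv, e1] at h
  simp only [Equiv.coe_mulLeft, star_apply, e2, inv_inv]
  rw [mul_inv_rev]
  exact h

instance : StarRing (L1 S) where
  star_involutive f := ext fun x => by
    simp only [star_apply]
    rw [S.inv_inv, inv_inv]
  star_mul := star_mul'
  star_add f g := ext fun x => by simp [star_apply]

instance : StarModule ℂ (L1 S) where
  star_smul c f := ext fun x => by simp [star_apply]

instance : NormedStarGroup (L1 S) where
  norm_star_le f := by
    rw [norm_eq, norm_eq]
    simp only [star_apply, S.norm_inv]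
    exact ((Equiv.inv G).tsum_eq fun x => ‖f x‖).le

end L1
end Fibers
/-! ### Rigidly symmetric groups -/

section Symmetric

/-- The plain convolution structure on `ℓ¹(G; B)`, i.e. that of the projective tensor product
of `ℓ¹(G)` and `B`: `(f * g)(x) = ∑_y f(y) g(y⁻¹x)` and `f^*(x) = f(x⁻¹)^*`. -/
def plainFibers (G : Type u) [Group G] (B : Type v) [NonUnitalCStarAlgebra B] :
    FiberStructure G B where
  mul _ _ := ContinuousLinearMap.mul ℂ B
  inv _ := (starL ℂ : B ≃L⋆[ℂ] B).toContinuousLinearMap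
  norm_mul_le _ _ a b := norm_mul_le a b
  mul_assoc _ _ _ a b c := mul_assoc a b c
  norm_inv _ a := norm_star a
  inv_inv _ a := star_star a
  inv_mul _ _ a b := star_mul a b

theorem plain_mul_apply {G : Type u} [Group G] {B : Type v} [NonUnitalCStarAlgebra B]
    (f g : L1 (plainFibers G B)) (x : G) : (f * g) x = ∑' y, f y * g (y⁻¹ * x) := rfl

theorem plain_star_apply {G : Type u} [Group G] {B : Type v} [NonUnitalCStarAlgebra B]
    (f : L1 (plainFibers G B)) (x : G) : (star f) x = star (f x⁻¹) := rfl

/-- A (possibly non-unital) complex `*`-algebra is symmetric if `b^* b` has non-negative spectrum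
for all `b`. The spectrum of an element of a non-unital algebra is the one in the unitization,
which is `quasispectrum`; for a unital algebra this adds at most the point `0`. -/
def IsSymmetric (𝔅 : Type u) [NonUnitalRing 𝔅] [Module ℂ 𝔅] [Star 𝔅] : Prop :=
  ∀ b : 𝔅, ∀ z ∈ quasispectrum ℂ (star b * b), 0 ≤ z.re ∧ z.im = 0

/-- A discrete group `G` is rigidly symmetric if `ℓ¹(G; B)`, which is the projective tensor product
of `ℓ¹(G)` and `B`, is symmetric for every `C^*`-algebra `B`. -/
def RigidlySymmetric (G : Type u) [Group G] : Prop :=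
  ∀ (B : Type v) [NonUnitalCStarAlgebra B], IsSymmetric (L1 (plainFibers G B))

end Symmetric

/-! ### Twisted actions and the twisted `ℓ¹`-algebra -/

section Twisted

/-- A twisted action `(α, ω)` of the discrete group `G` on the unital `C^*`-algebra `A`. -/
structure TwistedAction (G : Type u) [Group G] (A : Type v) [CStarAlgebra A] where
  α : G → A ≃⋆ₐ[ℂ] A
  ω : G → G → unitary A
  α_comp : ∀ x y a, α x (α y a) = (ω x y : A) * α (x * y) a * star (ω x y : A)
  cocycle : ∀ x y z, (ω x y : A) * (ω (x * y) z : A) = α x (ω y z : A) * (ω x (y * z) : A)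
  ω_one_right : ∀ x, ω x 1 = 1
  ω_one_left : ∀ x, ω 1 x = 1

namespace TwistedAction

variable {G : Type u} [Group G] {A : Type v} [CStarAlgebra A] (S : TwistedAction G A)

theorem star_ω_mul (x y : G) : star (S.ω x y : A) * (S.ω x y : A) = 1 :=
  Unitary.coe_star_mul_self _

theorem ω_mul_star (x y : G) : (S.ω x y : A) * star (S.ω x y : A) = 1 :=
  Unitary.coe_mul_star_self _

/-- The convolution structure of a twisted action; see `twisted_mul_apply` and
`twisted_star_apply` for the resulting operations. -/
def fibers : FiberStructure G A where
  mul x y := LinearMap.mkContinuous₂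
    (LinearMap.mk₂ ℂ (fun a b : A => a * S.α x b * (S.ω x y : A))
      (fun a a' b => by simp [add_mul]) (fun c a b => by simp)
      (fun a b b' => by simp [mul_add, add_mul]) (fun c a b => by simp)) 1
    (fun a b => by
      simp only [LinearMap.mk₂_apply, one_mul]
      rw [CStarRing.norm_mul_coe_unitary]
      exact (norm_mul_le _ _).trans_eq (by rw [StarAlgEquiv.norm_map]))
  inv x := LinearMap.mkContinuous
    { toFun := fun a : A => star (S.ω x x⁻¹ : A) * star (S.α x a)
      map_add' := fun a b => by simp [mul_add]
      map_smul' := fun c a => by simp } 1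
    (fun a => by
      change ‖star (S.ω x x⁻¹ : A) * star (S.α x a)‖ ≤ 1 * ‖a‖
      rw [one_mul, ← Unitary.coe_star, CStarRing.norm_coe_unitary_mul, norm_star,
        StarAlgEquiv.norm_map])
  norm_mul_le x y a b := by
    change ‖a * S.α x b * (S.ω x y : A)‖ ≤ _
    rw [CStarRing.norm_mul_coe_unitary]
    exact (norm_mul_le _ _).trans_eq (by rw [StarAlgEquiv.norm_map])
  mul_assoc x y z a b c := by
    change a * S.α x b * (S.ω x y : A) * S.α (x * y) c * (S.ω (x * y) z : A) =
      a * S.α x (b * S.α y c * (S.ω y z : A)) * (S.ω x (y * z) : A)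
    simp only [map_mul, S.α_comp, mul_assoc]
    rw [← S.cocycle, ← mul_assoc (star (S.ω x y : A)), S.star_ω_mul, one_mul]
  norm_inv x a := by
    change ‖star (S.ω x x⁻¹ : A) * star (S.α x a)‖ = ‖a‖
    rw [← Unitary.coe_star, CStarRing.norm_coe_unitary_mul, norm_star, StarAlgEquiv.norm_map]
  inv_inv x a := by
    change star (S.ω x x⁻¹ : A) *
      star (S.α x (star (S.ω x⁻¹ x⁻¹⁻¹ : A) * star (S.α x⁻¹ a))) = a
    have h1 : S.α 1 a = a := by
      apply (S.α 1).injective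
      simpa [S.ω_one_left] using S.α_comp 1 1 a
    have h2 : S.α x (S.ω x⁻¹ x : A) = (S.ω x x⁻¹ : A) := by
      simpa [S.ω_one_left, S.ω_one_right] using (S.cocycle x x⁻¹ x).symm
    rw [inv_inv, ← map_star (S.α x), star_mul, star_star, star_star, map_mul, S.α_comp, h2,
      mul_inv_cancel, h1, mul_assoc _ (star _), S.star_ω_mul, mul_one, ← mul_assoc, S.star_ω_mul,
      one_mul]
  inv_mul x y a b := by
    change star (S.ω (x * y)⁻¹ (x * y)⁻¹⁻¹ : A) *
        star (S.α (x * y)⁻¹ (a * S.α x b * (S.ω x y : A))) =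
      star (S.ω y⁻¹ y⁻¹⁻¹ : A) * star (S.α y⁻¹ b) *
        S.α y⁻¹ (star (S.ω x⁻¹ x⁻¹⁻¹ : A) * star (S.α x⁻¹ a)) * (S.ω y⁻¹ x⁻¹ : A)
    have e1 : (x * y)⁻¹ * x = y⁻¹ := by group
    have e2 : y⁻¹ * x⁻¹ = (x * y)⁻¹ := by group
    have h1 := S.cocycle (x * y)⁻¹ x y
    have h2 := S.cocycle y⁻¹ x⁻¹ x
    rw [e1] at h1
    rw [e2, inv_mul_cancel, S.ω_one_right, OneMemClass.coe_one, mul_one] at h2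
    simp only [inv_inv, map_mul, S.α_comp, map_star, star_mul, star_star, e1, e2, ← h2]
    have h3 := congrArg star h1
    simp only [star_mul] at h3
    have k : ∀ (c : A) (x y : G), c * star (S.ω x y : A) * (S.ω x y : A) = c := by
      intro c x y
      rw [mul_assoc, S.star_ω_mul, mul_one]
    simp only [← mul_assoc, ← h3, k]

/-- The `ℓ¹`-twisted crossed product `ℓ¹_{α,ω}(G; A)`. -/
abbrev TwistedL1 : Type (max u v) := L1 S.fibers

theorem twisted_mul_apply (f g : S.TwistedL1) (x : G) :
    (f * g) x = ∑' y, f y * S.α y (g (y⁻¹ * x)) * (S.ω y (y⁻¹ * x) : A) := rfl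

theorem twisted_star_apply (f : S.TwistedL1) (x : G) :
    (star f) x = star (S.ω x x⁻¹ : A) * star (S.α x (f x⁻¹)) := rfl

end TwistedAction

end Twisted

/-! ### The enveloping `C^*`-algebra -/

section Enveloping

variable (𝔅 : Type u) [NonUnitalNormedRing 𝔅] [StarRing 𝔅] [NormedStarGroup 𝔅] [CompleteSpace 𝔅]
  [NormedSpace ℂ 𝔅] [IsScalarTower ℂ 𝔅 𝔅] [SMulCommClass ℂ 𝔅 𝔅] [StarModule ℂ 𝔅]

/-- A `*`-representation of the Banach `*`-algebra `𝔅` on a Hilbert space. -/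
structure HilbertRep : Type (u + 1) where
  H : Type u
  [normed : NormedAddCommGroup H]
  [inner : InnerProductSpace ℂ H]
  [complete : CompleteSpace H]
  toHom : 𝔅 →⋆ₙₐ[ℂ] (H →L[ℂ] H)

attribute [instance] HilbertRep.normed HilbertRep.inner HilbertRep.complete


variable {𝔅} in
/-- A `*`-homomorphism from a Banach `*`-algebra to a `C^*`-algebra is contractive. -/
theorem norm_hom_le {D : Type*} [NonUnitalCStarAlgebra D] (φ : 𝔅 →⋆ₙₐ[ℂ] D) (b : 𝔅) :
    ‖φ b‖ ≤ ‖b‖ := by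
  have key : ∀ h : 𝔅, IsSelfAdjoint h → ‖φ h‖ ≤ ‖h‖ := by
    intro h hh
    have hs : IsSelfAdjoint (φ h : Unitization ℂ D) := (hh.map φ).inr ℂ
    have hr : spectralRadius ℂ (φ h : Unitization ℂ D) ≤ (‖h‖₊ : ℝ≥0∞) := by
      refine iSup₂_le fun k hk => ?_
      rw [← Unitization.quasispectrum_eq_spectrum_inr ℂ] at hk
      have hk' := NonUnitalAlgHom.quasispectrum_apply_subset φ h hk
      rw [Unitization.quasispectrum_eq_spectrum_inr ℂ,
        ← AlgEquiv.spectrum_eq (WithLp.unitizationAlgEquiv (𝕜 := ℂ) (A := 𝔅) ℂ).symm] at hk'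
      have h2 := spectrum.norm_le_norm_mul_of_mem hk'
      have h3 : ‖(1 : WithLp 1 (Unitization ℂ 𝔅))‖ = 1 := by
        rw [WithLp.unitization_norm_def]
        change ‖(1 : ℂ)‖ + ‖(0 : 𝔅)‖ = 1
        simp
      have h4 : ‖(WithLp.unitizationAlgEquiv (𝕜 := ℂ) (A := 𝔅) ℂ).symm (h : Unitization ℂ 𝔅)‖
          = ‖h‖ := WithLp.unitization_norm_inr h
      rw [h3, h4, mul_one] at h2
      exact_mod_cast h2
    rw [hs.spectralRadius_eq_nnnorm, Unitization.nnnorm_inr] at hr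
    exact_mod_cast hr
  have h1 := key (star b * b) (.star_mul_self b)
  rw [map_mul, map_star, CStarRing.norm_star_mul_self] at h1
  have h2 : ‖star b * b‖ ≤ ‖b‖ * ‖b‖ := (norm_mul_le _ _).trans_eq (by rw [norm_star])
  exact le_of_sq_le_sq (by nlinarith) (norm_nonneg _)

variable {𝔅} in
theorem memlp_rep (b : 𝔅) :
    Memℓp (E := fun π : HilbertRep 𝔅 => π.H →L[ℂ] π.H) (fun π => π.toHom b) ∞ :=
  memℓp_infty ⟨‖b‖, by rintro _ ⟨π, rfl⟩; exact norm_hom_le π.toHom b⟩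

/-- The `C^*`-algebra of bounded families of operators `T_π`, one on each representation
space `π` of `𝔅`, with the supremum norm. -/
def RepProduct : Type (u + 1) := lp (fun π : HilbertRep 𝔅 => π.H →L[ℂ] π.H) ∞

instance : NonUnitalCStarAlgebra (RepProduct 𝔅) :=
  inferInstanceAs (NonUnitalCStarAlgebra (lp (fun π : HilbertRep 𝔅 => π.H →L[ℂ] π.H) ∞))

/-- The universal representation `b ↦ (π b)_π` of `𝔅`. -/
def universalRep : 𝔅 →⋆ₙₐ[ℂ] RepProduct 𝔅 where
  toFun b := ⟨fun π => π.toHom b, memlp_rep b⟩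
  map_smul' c b := lp.ext (funext fun π => map_smul π.toHom c b)
  map_zero' := lp.ext (funext fun π => map_zero π.toHom)
  map_add' a b := lp.ext (funext fun π => map_add π.toHom a b)
  map_mul' a b := lp.ext (funext fun π => map_mul π.toHom a b)
  map_star' b := lp.ext (funext fun π => map_star π.toHom b)

/-- The enveloping `C^*`-algebra of the Banach `*`-algebra `𝔅`: the norm closure of the image of
`𝔅` under its universal representation. So it is the (Hausdorff) completion of `𝔅` in the
`C^*`-seminorm `b ↦ sup ‖π b‖`, where `π` runs over all `*`-representations. -/
def Enveloping : Type (u + 1) :=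
  (NonUnitalStarAlgHom.range (universalRep 𝔅)).topologicalClosure

instance : NonUnitalCStarAlgebra (Enveloping 𝔅) :=
  NonUnitalStarSubalgebra.nonUnitalCStarAlgebra
    (NonUnitalStarAlgHom.range (universalRep 𝔅)).topologicalClosure
    (h_closed := NonUnitalStarSubalgebra.isClosed_topologicalClosure _)

/-- The canonical `*`-homomorphism of `𝔅` into its enveloping `C^*`-algebra. -/
def toEnveloping : 𝔅 →⋆ₙₐ[ℂ] Enveloping 𝔅 where
  toFun b := ⟨universalRep 𝔅 b, subset_closure ⟨b, rfl⟩⟩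
  map_smul' c b := Subtype.ext (map_smul (universalRep 𝔅) c b)
  map_zero' := Subtype.ext (map_zero (universalRep 𝔅))
  map_add' a b := Subtype.ext (map_add (universalRep 𝔅) a b)
  map_mul' a b := Subtype.ext (map_mul (universalRep 𝔅) a b)
  map_star' b := Subtype.ext (map_star (universalRep 𝔅) b)

end Enveloping

/-! ### Twisted crossed products and Fredholm inverse closedness -/

section Crossed

namespace TwistedAction

variable {G : Type u} [Group G] {A : Type v} [CStarAlgebra A] (S : TwistedAction G A)

/-- The twisted crossed product `C^*`-algebra `A ⋊ G`. -/
abbrev CrossedProduct : Type (max u v + 1) := Enveloping S.TwistedL1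

/-- The canonical map `ℓ¹_{α,ω}(G; A) → A ⋊ G`. -/
abbrev toCrossedProduct : S.TwistedL1 →⋆ₙₐ[ℂ] S.CrossedProduct := toEnveloping S.TwistedL1

/-- For an invariant closed ideal `J` of `A`, the ideal `J ⋊ G` of `A ⋊ G`:
the closure of (the image of) `ℓ¹_{α,ω}(G; J)`. -/
def crossedIdeal (J : Ideal A) : Set S.CrossedProduct :=
  closure (S.toCrossedProduct '' {f | ∀ x, f x ∈ J})

end TwistedAction

variable {H : Type w} [NormedAddCommGroup H] [InnerProductSpace ℂ H] [CompleteSpace H]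

/-- On a Hilbert space, Mathlib's Fredholm operators are the operators with closed range and
finite-dimensional kernel such that the adjoint has a finite-dimensional kernel. -/
theorem isFredholm_iff (T : H →L[ℂ] H) :
    T.IsFredholm ↔ IsClosed (Set.range T) ∧ FiniteDimensional ℂ T.ker ∧
      FiniteDimensional ℂ (ContinuousLinearMap.adjoint T).ker := by
  have key : IsClosed (Set.range T) →
      (FiniteDimensional ℂ (ContinuousLinearMap.adjoint T).ker ↔ T.range.CoFG) := by
    intro hc
    have : CompleteSpace T.range := hc.completeSpace_coe
    rw [← ContinuousLinearMap.orthogonal_range]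
    let e := Submodule.quotientEquivOfIsCompl _ _ (Submodule.isCompl_orthogonal T.range)
    exact (Module.Finite.equiv_iff e).symm
  constructor
  · intro h
    exact ⟨h.isClosed_range, h.finite_ker, (key h.isClosed_range).2 h.finite_coker⟩
  · rintro ⟨hc, hk, ha⟩
    have : CompleteSpace T.range := hc.completeSpace_coe
    refine ⟨?_, hc, hk, (key hc).1 ha, .of_finiteDimensional _⟩
    have hq : Topology.IsQuotientMap T.rangeRestrict :=
      T.rangeRestrict.isQuotientMap (LinearMap.surjective_rangeRestrict _)
    exact Topology.isStrictMap_iff_isQuotientMap_rangeFactorization.2 hq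

/-- A `*`-algebra `F` of bounded operators on `H` is Fredholm inverse closed if
every Fredholm operator in `F` has an inverse modulo compact operators that lies in `F`. -/
def FredholmInverseClosed (F : NonUnitalStarSubalgebra ℂ (H →L[ℂ] H)) : Prop :=
  ∀ T ∈ F, T.IsFredholm → ∃ S ∈ F, ∃ K L : H →L[ℂ] H,
    IsCompactOperator K ∧ IsCompactOperator L ∧ S * T = 1 + K ∧ T * S = 1 + L

end Crossed

end TwistedCrossed

end

/-!
Write `𝔅 = ℓ¹_{α,ω}(G; A)`.

*Symmetry of quotients.* A `*`-homomorphism `ρ` of `𝔅` into a `C^*`-algebra `B` induces the diagonal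
`*`-homomorphism `f ↦ (x ↦ ρ (f(x) δ_x))` into the ordinary algebra `ℓ¹(G; B)`, which is symmetric
by rigid symmetry. Since `*`-homomorphisms of `C^*`-algebras lift norms from their images, the range
of the diagonal homomorphism is closed, hence inherits symmetry. If `ρ` is faithful on the image of
`𝔅` in its enveloping algebra, then every quotient of `𝔅` by a closed `*`-ideal containing the
kernel of its representations is a quotient of this range, and so is symmetric as well.

*Parametrices.* Let `N` consist of the elements of `𝔅` represented by compact operators and suppose
that `b` has a Fredholm image `T`, with `V T = 1 + K`. If `b` had no left inverse modulo `N`,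
symmetry of `𝔅/N` and the GNS construction would give a representation of `𝔅` which vanishes on `N`
and has a nonzero vector `ξ` killed by `b` and fixed by `1`. It extends to the enveloping algebra,
where it annihilates all compact operators, so that `V T = 1 + K` gives `‖ξ‖ ≤ ‖V‖ ‖b ξ‖ = 0`.
Hence `b` has a left inverse modulo `N`, and a left inverse of `T` modulo the compact operators is
also a right inverse, because `T` has a right inverse `V`.
-/

noncomputable section

namespace TwistedCrossed

/-! ### Square roots in Banach algebras -/

section Sqrt

open Filter Topology

theorem abs_choose_half_le_one (n : ℕ) : |Ring.choose (1 / 2 : ℝ) n| ≤ 1 := by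
  induction n with
  | zero => simp
  | succ n ih =>
    have hn : (0 : ℝ) < n + 1 := by positivity
    have hrec : (n + 1 : ℝ) * Ring.choose (1 / 2 : ℝ) (n + 1) =
        Ring.choose (1 / 2 : ℝ) n * (1 / 2 - n) := by
      simpa using Ring.choose_smul_choose (1 / 2 : ℝ) (Nat.le_succ n)
    have hfactor : |1 / 2 - (n : ℝ)| ≤ n + 1 := by
      rw [abs_le]
      constructor <;> linarith
    refine le_of_mul_le_mul_left ?_ hn
    calc (n + 1 : ℝ) * |Ring.choose (1 / 2 : ℝ) (n + 1)|
        = |Ring.choose (1 / 2 : ℝ) n| * |1 / 2 - (n : ℝ)| := by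
          rw [← abs_mul, ← hrec, abs_mul, abs_of_pos hn]
      _ ≤ 1 * (n + 1) := mul_le_mul ih hfactor (abs_nonneg _) zero_le_one
      _ = (n + 1) * 1 := mul_comm _ _

theorem sum_antidiagonal_choose_half_smul_pow {R : Type*} [Ring R] [Algebra ℝ R] (x : R) (n : ℕ) :
    ∑ kl ∈ Finset.HasAntidiagonal.antidiagonal n,
        (Ring.choose (1 / 2 : ℝ) kl.1 • x ^ kl.1) * (Ring.choose (1 / 2 : ℝ) kl.2 • x ^ kl.2) =
      (Nat.choose 1 n : ℝ) • x ^ n := by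
  have vandermonde := Ring.add_choose_eq n (Commute.all (1 / 2 : ℝ) (1 / 2))
  rw [add_halves, ← Nat.cast_one, Ring.choose_natCast] at vandermonde
  rw [vandermonde, Finset.sum_smul]
  refine Finset.sum_congr rfl fun kl hkl => ?_
  rw [smul_mul_smul_comm, ← pow_add, Finset.HasAntidiagonal.mem_antidiagonal.1 hkl, Nat.cast_one]

variable {Q : Type u} [NormedRing Q] [NormedAlgebra ℂ Q] [CompleteSpace Q] {x : Q}

theorem summable_norm_pow_of_spectralRadius_lt_one (hx : spectralRadius ℂ x < 1) :
    Summable fun n => ‖x ^ n‖ := by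
  obtain ⟨q, hq, hq1⟩ := exists_between hx
  lift q to NNReal using (hq1.trans ENNReal.one_lt_top).ne
  have hroot := (spectrum.pow_nnnorm_pow_one_div_tendsto_nhds_spectralRadius x).eventually
    (gt_mem_nhds hq)
  refine .of_norm_bounded_eventually_nat
    (summable_geometric_of_lt_one q.2 (by exact_mod_cast hq1)) ?_
  filter_upwards [hroot, eventually_gt_atTop 0] with n hn hn0
  have hn' : (0 : ℝ) < n := by exact_mod_cast hn0
  have hpow := ENNReal.rpow_le_rpow hn.le hn'.le
  rw [← ENNReal.rpow_mul, one_div_mul_cancel hn'.ne', ENNReal.rpow_one,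
    ENNReal.rpow_natCast] at hpow
  rw [norm_norm]
  exact_mod_cast hpow

theorem summable_norm_choose_half_smul_pow (hx : spectralRadius ℂ x < 1) :
    Summable fun n => ‖Ring.choose (1 / 2 : ℝ) n • x ^ n‖ := by
  refine (summable_norm_pow_of_spectralRadius_lt_one hx).of_nonneg_of_le
    (fun _ => norm_nonneg _) fun n => ?_
  rw [norm_smul, Real.norm_eq_abs]
  exact mul_le_of_le_one_left (norm_nonneg _) (abs_choose_half_le_one n)

theorem tsum_choose_half_smul_pow_mul_self (hx : spectralRadius ℂ x < 1) :
    (∑' n, Ring.choose (1 / 2 : ℝ) n • x ^ n) * (∑' n, Ring.choose (1 / 2 : ℝ) n • x ^ n) =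
      1 + x := by
  have hsum := summable_norm_choose_half_smul_pow hx
  rw [tsum_mul_tsum_eq_tsum_sum_antidiagonal_of_summable_norm hsum hsum,
    tsum_congr (sum_antidiagonal_choose_half_smul_pow x), tsum_eq_sum (s := Finset.range 2)]
  · simp [Finset.sum_range_succ]
  · intro n hn
    rw [Nat.choose_eq_zero_of_lt (by simpa using hn), Nat.cast_zero, zero_smul]

theorem exists_isSelfAdjoint_mul_self_eq_one_add [StarRing Q] [StarModule ℂ Q] [NormedStarGroup Q]
    (hx : spectralRadius ℂ x < 1) (hs : IsSelfAdjoint x) :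
    ∃ y : Q, IsSelfAdjoint y ∧ y * y = 1 + x := by
  refine ⟨_, ?_, tsum_choose_half_smul_pow_mul_self hx⟩
  rw [IsSelfAdjoint, tsum_star]
  refine tsum_congr fun n => ?_
  rw [star_smul, star_pow, hs.star_eq, star_trivial]

end Sqrt

/-! ### Positive elements of symmetric Banach `*`-algebras -/

section Positive

open scoped ComplexOrder

section Spectrum

variable {Q : Type u} [Ring Q] [Algebra ℂ Q]

theorem mem_spectrum_add_algebraMap_real {h : Q} {t : ℝ} {z : ℂ} :
    z ∈ spectrum ℂ (h + algebraMap ℝ Q t) ↔ z - t ∈ spectrum ℂ h := by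
  rw [← spectrum.add_mem_add_iff (r := z - t) (s := (t : ℂ)), sub_add_cancel,
    IsScalarTower.algebraMap_apply ℝ ℂ Q, Complex.coe_algebraMap, add_comm]

theorem mem_spectrum_real_smul {h : Q} {t : ℝ} (ht : t ≠ 0) {z : ℂ} :
    z ∈ spectrum ℂ (t • h) ↔ (t : ℂ)⁻¹ * z ∈ spectrum ℂ h := by
  have hunit : t • h = (Units.mk0 (t : ℂ) (by exact_mod_cast ht)) • h := by
    rw [Units.smul_mk0, Complex.coe_smul]
  rw [hunit, spectrum.unit_smul_eq_smul, Set.mem_smul_set_iff_inv_smul_mem]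
  simp [Units.smul_def]

theorem not_isUnit_real_smul [Nontrivial Q] {b : Q} (hb : ¬ IsUnit b) (t : ℝ) :
    ¬ IsUnit (t • b) := by
  rcases eq_or_ne t 0 with rfl | ht
  · simp
  · rwa [← Units.smul_mk0 ht, isUnit_smul_iff]

end Spectrum

variable {Q : Type u} [NormedRing Q] [NormedAlgebra ℂ Q] [StarRing Q] {h k : Q}

/-- A self-adjoint element with spectrum in `[0, ∞)`; this is the notion of positivity available in
a Banach `*`-algebra that need not be a `C^*`-algebra. -/
def SpectralNonneg (h : Q) : Prop := IsSelfAdjoint h ∧ ∀ z ∈ spectrum ℂ h, 0 ≤ z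

/-- A self-adjoint element with spectrum in `(0, ∞)`, i.e. an invertible `SpectralNonneg` one. -/
def SpectralPos (h : Q) : Prop := IsSelfAdjoint h ∧ ∀ z ∈ spectrum ℂ h, 0 < z

theorem SpectralPos.isUnit (hh : SpectralPos h) : IsUnit h := by
  rw [← spectrum.zero_notMem_iff ℂ]
  exact fun h0 => (hh.2 0 h0).false

theorem IsSymmetric.spectralNonneg_star_mul_self (hQ : IsSymmetric Q) (x : Q) :
    SpectralNonneg (star x * x) := by
  refine ⟨.star_mul_self x, fun z hz => ?_⟩
  obtain ⟨hre, him⟩ := hQ x z (spectrum_subset_quasispectrum ℂ _ hz)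
  exact Complex.nonneg_iff.2 ⟨hre, him.symm⟩

theorem IsSymmetric.im_eq_zero_of_mem_spectrum (hQ : IsSymmetric Q) (hh : IsSelfAdjoint h) {z : ℂ}
    (hz : z ∈ spectrum ℂ h) : z.im = 0 := by
  have hsq := (hQ.spectralNonneg_star_mul_self h).2 (z ^ 2) (by
    rw [hh.star_eq, ← sq]
    exact spectrum.pow_mem_pow h 2 hz)
  by_contra him
  obtain ⟨hre_sq, him_sq⟩ := Complex.nonneg_iff.1 hsq
  simp only [sq, Complex.mul_re, Complex.mul_im] at hre_sq him_sq
  have hre : z.re = 0 := by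
    have : z.re * z.im = 0 := by linarith
    simpa [him] using this
  have := mul_self_pos.2 him
  rw [hre] at hre_sq
  linarith

section StarModule

variable [StarModule ℂ Q]

theorem isSelfAdjoint_algebraMap_real (t : ℝ) : IsSelfAdjoint (algebraMap ℝ Q t) :=
  .algebraMap Q (star_trivial t)

theorem SpectralNonneg.add_algebraMap (hh : SpectralNonneg h) {t : ℝ} (ht : 0 < t) :
    SpectralPos (h + algebraMap ℝ Q t) := by
  refine ⟨hh.1.add (isSelfAdjoint_algebraMap_real t), fun z hz => ?_⟩
  have hzt := hh.2 _ (mem_spectrum_add_algebraMap_real.1 hz)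
  exact (Complex.zero_lt_real.2 ht).trans_le (sub_nonneg.1 hzt)

theorem SpectralNonneg.smul (hh : SpectralNonneg h) {t : ℝ} (ht : 0 ≤ t) :
    SpectralNonneg (t • h) := by
  refine ⟨(IsSelfAdjoint.all t).smul hh.1, fun z hz => ?_⟩
  rcases subsingleton_or_nontrivial Q with _ | _
  · simp [spectrum.of_subsingleton] at hz
  rcases ht.eq_or_lt with rfl | ht
  · rw [zero_smul, spectrum.zero_eq, Set.mem_singleton_iff] at hz
    exact hz.ge
  · have hz' := hh.2 _ ((mem_spectrum_real_smul ht.ne').1 hz)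
    have ht' : (0 : ℂ) < t := Complex.zero_lt_real.2 ht
    simpa [ht.ne'] using mul_nonneg ht'.le hz'

section Complete

variable [CompleteSpace Q]

theorem IsSymmetric.spectralNonneg_algebraMap_sub (hQ : IsSymmetric Q) (hh : IsSelfAdjoint h)
    {M : ℝ} (hM : ‖h‖ * ‖(1 : Q)‖ ≤ M) : SpectralNonneg (algebraMap ℝ Q M - h) := by
  have hs := (isSelfAdjoint_algebraMap_real M).sub hh
  refine ⟨hs, fun z hz => Complex.nonneg_iff.2 ⟨?_, (hQ.im_eq_zero_of_mem_spectrum hs hz).symm⟩⟩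
  rw [sub_eq_add_neg, add_comm, mem_spectrum_add_algebraMap_real] at hz
  have hnorm := spectrum.norm_le_norm_mul_of_mem hz
  rw [norm_neg] at hnorm
  have hre := (abs_le.1 ((Complex.abs_re_le_norm _).trans (hnorm.trans hM))).1
  simp only [Complex.sub_re, Complex.ofReal_re] at hre
  linarith

variable [NormedStarGroup Q]

theorem exists_isSelfAdjoint_mul_self_eq_algebraMap_sub (hh : IsSelfAdjoint h) {M : ℝ}
    (hM0 : 0 < M) (hM : ∀ z ∈ spectrum ℂ h, ‖z‖ < M) :
    ∃ y : Q, IsSelfAdjoint y ∧ y * y = algebraMap ℝ Q M - h := by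
  have hr : spectralRadius ℂ ((-M⁻¹) • h) < 1 := by
    rcases subsingleton_or_nontrivial Q with _ | _
    · simp [spectrum.SpectralRadius.of_subsingleton]
    refine spectrum.spectralRadius_lt_of_forall_lt _ (r := 1) fun z hz => ?_
    have hz' := hM _ ((mem_spectrum_real_smul (neg_ne_zero.2 (inv_ne_zero hM0.ne'))).1 hz)
    have hnorm : M * ‖z‖ < M * 1 := by simpa [abs_of_pos hM0] using hz'
    exact NNReal.coe_lt_coe.1 (lt_of_mul_lt_mul_left hnorm hM0.le)
  obtain ⟨y, hy, hyy⟩ :=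
    exists_isSelfAdjoint_mul_self_eq_one_add hr ((IsSelfAdjoint.all (-M⁻¹)).smul hh)
  refine ⟨√M • y, (IsSelfAdjoint.all √M).smul hy, ?_⟩
  rw [smul_mul_smul_comm, Real.mul_self_sqrt hM0.le, hyy, smul_add, smul_smul,
    Algebra.algebraMap_eq_smul_one, mul_neg, mul_inv_cancel₀ hM0.ne', neg_smul, one_smul,
    sub_eq_add_neg]

theorem SpectralPos.exists_mul_self_eq (hh : SpectralPos h) :
    ∃ y : Q, IsSelfAdjoint y ∧ y * y = h := by
  set M : ℝ := ‖h‖ * ‖(1 : Q)‖ + 1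
  have hM0 : 0 < M := by positivity
  have hlt : ∀ z ∈ spectrum ℂ (algebraMap ℝ Q M - h), ‖z‖ < M := by
    intro z hz
    rw [IsScalarTower.algebraMap_apply ℝ ℂ Q, ← spectrum.singleton_sub_eq] at hz
    obtain ⟨_, rfl, w, hw, rfl⟩ := hz
    obtain ⟨hre, him⟩ := Complex.pos_iff.1 (hh.2 w hw)
    have hle := (Complex.re_le_norm w).trans (spectrum.norm_le_norm_mul_of_mem hw)
    have hw' : w = (w.re : ℂ) := Complex.ext rfl him.symm
    change ‖(M : ℂ) - w‖ < M
    rw [hw', ← Complex.ofReal_sub, Complex.norm_real, Real.norm_eq_abs, abs_lt]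
    constructor <;> linarith
  simpa using exists_isSelfAdjoint_mul_self_eq_algebraMap_sub
    ((isSelfAdjoint_algebraMap_real M).sub hh.1) hM0 hlt

theorem SpectralPos.exists_unit_mul_self_eq (hh : SpectralPos h) :
    ∃ y : Qˣ, IsSelfAdjoint (y : Q) ∧ (y * y : Q) = h := by
  obtain ⟨y, hy, rfl⟩ := hh.exists_mul_self_eq
  obtain ⟨y, rfl⟩ := ((Commute.refl y).isUnit_mul_iff.1 hh.isUnit).1
  exact ⟨y, hy, rfl⟩

/-- Writing `h = y²` and `k = x²` gives `h + k = y (1 + a* a) y` with `a = x y⁻¹`. -/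
theorem IsSymmetric.isUnit_add (hQ : IsSymmetric Q) (hh : SpectralPos h) (hk : SpectralPos k) :
    IsUnit (h + k) := by
  obtain ⟨y, hy, rfl⟩ := hh.exists_unit_mul_self_eq
  obtain ⟨x, hx, rfl⟩ := hk.exists_mul_self_eq
  have hy' : star (↑y⁻¹ : Q) = ↑y⁻¹ := by
    have : star y = y := Units.ext hy
    rw [← Units.coe_star, star_inv, this]
  have hone := ((hQ.spectralNonneg_star_mul_self (x * ↑y⁻¹)).add_algebraMap one_pos).isUnit
  have hfactor : (y : Q) * y + x * x =
      y * (star (x * ↑y⁻¹) * (x * ↑y⁻¹) + algebraMap ℝ Q 1) * y := by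
    rw [star_mul, hx.star_eq, hy', map_one, mul_add, add_mul, mul_one, add_comm]
    simp [mul_assoc]
  rw [hfactor]
  exact (y.isUnit.mul hone).mul y.isUnit

theorem IsSymmetric.spectralNonneg_add (hQ : IsSymmetric Q) (hh : SpectralNonneg h)
    (hk : SpectralNonneg k) : SpectralNonneg (h + k) := by
  refine ⟨hh.1.add hk.1, fun z hz => ?_⟩
  have him := hQ.im_eq_zero_of_mem_spectrum (hh.1.add hk.1) hz
  refine Complex.nonneg_iff.2 ⟨?_, him.symm⟩
  by_contra! hneg
  have ht : 0 < -z.re / 2 := by linarith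
  have hunit := hQ.isUnit_add (hh.add_algebraMap ht) (hk.add_algebraMap ht)
  have hz' : z = -((-z.re / 2 : ℝ) : ℂ) - ((-z.re / 2 : ℝ) : ℂ) := by
    refine Complex.ext ?_ (by simp [him])
    simp only [Complex.sub_re, Complex.neg_re, Complex.ofReal_re]
    ring
  rw [spectrum.mem_iff, hz', map_sub, map_neg, ← Complex.coe_algebraMap,
    ← IsScalarTower.algebraMap_apply ℝ ℂ Q, ← IsUnit.neg_iff] at hz
  refine hz ?_
  convert hunit using 1
  abel

end Complete

end StarModule

end Positive

/-! ### Positive functionals and the GNS construction for Banach `*`-algebras -/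

section States

open Complex

open scoped ComplexOrder

theorem exists_linearMap_eq_on_selfAdjoint {E : Type*} [AddCommGroup E] [Module ℂ E]
    [StarAddMonoid E] [StarModule ℂ E] (φ : selfAdjoint E →ₗ[ℝ] ℝ) :
    ∃ F : E →ₗ[ℂ] ℂ, ∀ h : selfAdjoint E, F h = φ h := by
  refine ⟨Module.Dual.extendRCLike (𝕜 := ℂ) (φ ∘ₗ realPart), fun h => ?_⟩
  have him : realPart ((I : ℂ) • (h : E)) = 0 := by
    rw [realPart_I_smul, h.2.imaginaryPart, neg_zero]
  have hre : realPart (h : E) = h := Subtype.ext h.2.coe_realPart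
  rw [Module.Dual.extendRCLike_apply]
  simp [him, hre]

/-- A positive linear functional on a `*`-algebra. -/
structure PosFunctional (Q : Type u) [Ring Q] [Algebra ℂ Q] [Star Q] where
  toLin : Q →ₗ[ℂ] ℂ
  nonneg : ∀ x, 0 ≤ toLin (star x * x)

variable {Q : Type u} [NormedRing Q] [NormedAlgebra ℂ Q] [StarRing Q]

theorem SpectralNonneg.nonneg_of_not_isUnit [Nontrivial Q] {b : Q} (hb : ¬ IsUnit b) {s t : ℝ}
    (h : SpectralNonneg (s • (1 : Q) + t • b)) : 0 ≤ s := by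
  refine Complex.zero_le_real.1 (h.2 _ ?_)
  rw [← Algebra.algebraMap_eq_smul_one, add_comm, mem_spectrum_add_algebraMap_real, sub_self,
    spectrum.zero_mem_iff]
  exact not_isUnit_real_smul hb t

variable [StarModule ℂ Q] [CompleteSpace Q] [NormedStarGroup Q]

/-- The convex cone generated by the elements of non-negative spectrum and the line through `b`.
A functional that is non-negative on it vanishes at `b`. -/
def spectralConeAddLine (hQ : IsSymmetric Q) (b : selfAdjoint Q) :
    PointedCone ℝ (selfAdjoint Q) where
  carrier := {h | ∃ t : ℝ, SpectralNonneg (h + t • b : Q)}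
  zero_mem' := ⟨0, by simpa using hQ.spectralNonneg_star_mul_self 0⟩
  add_mem' := by
    rintro h k ⟨s, hs⟩ ⟨t, ht⟩
    refine ⟨s + t, ?_⟩
    rw [AddSubgroup.coe_add, add_smul, add_add_add_comm]
    exact hQ.spectralNonneg_add hs ht
  smul_mem' := by
    rintro ⟨c, hc⟩ h ⟨s, hs⟩
    refine ⟨c * s, ?_⟩
    have hsmul : (((⟨c, hc⟩ : {r : ℝ // 0 ≤ r}) • h : selfAdjoint Q) : Q) = c • (h : Q) := rfl
    rw [hsmul, mul_smul, ← smul_add]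
    exact hs.smul hc

theorem exists_add_mem_spectralConeAddLine (hQ : IsSymmetric Q) (b k : selfAdjoint Q) :
    ∃ M : ℝ, M • (1 : selfAdjoint Q) + k ∈ spectralConeAddLine hQ b := by
  refine ⟨‖(-k : Q)‖ * ‖(1 : Q)‖, 0, ?_⟩
  have := hQ.spectralNonneg_algebraMap_sub k.2.neg le_rfl
  rw [sub_neg_eq_add, Algebra.algebraMap_eq_smul_one] at this
  simpa using this

theorem IsSymmetric.exists_real_state [Nontrivial Q] (hQ : IsSymmetric Q) (b : selfAdjoint Q)
    (hb : ¬ IsUnit (b : Q)) :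
    ∃ φ : selfAdjoint Q →ₗ[ℝ] ℝ, φ 1 = 1 ∧ φ b = 0 ∧
      ∀ h : selfAdjoint Q, SpectralNonneg (h : Q) → 0 ≤ φ h := by
  have hone : (1 : selfAdjoint Q) ≠ 0 := Subtype.coe_ne_coe.1 one_ne_zero
  obtain ⟨φ, hφ, hpos⟩ := riesz_extension (spectralConeAddLine hQ b)
    (LinearPMap.mkSpanSingleton (1 : selfAdjoint Q) (1 : ℝ) hone)
    (by
      rintro ⟨x, hx⟩ ⟨t, ht⟩
      obtain ⟨s, rfl⟩ := Submodule.mem_span_singleton.1 hx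
      rw [LinearPMap.mkSpanSingleton'_apply, RingHom.id_apply, smul_eq_mul, mul_one]
      exact ht.nonneg_of_not_isUnit hb)
    (fun k => by
      obtain ⟨M, hM⟩ := exists_add_mem_spectralConeAddLine hQ b k
      exact ⟨⟨_, Submodule.smul_mem _ M (Submodule.mem_span_singleton_self _)⟩, hM⟩)
  refine ⟨φ, ?_, ?_, fun h hh => hpos h ⟨0, by simpa using hh⟩⟩
  · rw [hφ ⟨1, Submodule.mem_span_singleton_self _⟩]
    exact LinearPMap.mkSpanSingleton_apply ℝ ℝ hone (1 : ℝ)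
  · have hle := hpos b ⟨-1, by simpa using hQ.spectralNonneg_star_mul_self 0⟩
    have hge := hpos (-b) ⟨1, by simpa using hQ.spectralNonneg_star_mul_self 0⟩
    rw [map_neg] at hge
    linarith

theorem IsSymmetric.exists_posFunctional (hQ : IsSymmetric Q) {b : Q} (hbs : IsSelfAdjoint b)
    (hb : ¬ IsUnit b) : ∃ f : PosFunctional Q, f.toLin 1 = 1 ∧ f.toLin b = 0 := by
  rcases subsingleton_or_nontrivial Q with _ | _
  · exact absurd (isUnit_of_subsingleton b) hb
  obtain ⟨φ, hone, hzero, hpos⟩ := hQ.exists_real_state ⟨b, hbs⟩ hb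
  obtain ⟨F, hF⟩ := exists_linearMap_eq_on_selfAdjoint φ
  refine ⟨⟨F, fun x => ?_⟩, ?_, ?_⟩
  · rw [hF ⟨star x * x, .star_mul_self x⟩, Complex.zero_le_real]
    exact hpos _ (hQ.spectralNonneg_star_mul_self x)
  · simpa [hone] using hF 1
  · simpa [hzero] using hF ⟨b, hbs⟩

end States

section GNS

open Complex UniformSpace

open scoped ComplexOrder

namespace PosFunctional

section Algebraic

variable {Q : Type u} [Ring Q] [Algebra ℂ Q] [StarRing Q] [StarModule ℂ Q] (f : PosFunctional Q)

theorem map_star (x : Q) : f.toLin (star x) = star (f.toLin x) := by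
  have hx := (Complex.nonneg_iff.1 (f.nonneg x)).2
  have hone := (Complex.nonneg_iff.1 (f.nonneg 1)).2
  have hadd := (Complex.nonneg_iff.1 (f.nonneg (x + 1))).2
  have hI := (Complex.nonneg_iff.1 (f.nonneg (x + I • 1))).2
  simp only [star_add, star_smul, star_one, mul_add, add_mul, one_mul, mul_one, map_add,
    add_im, smul_mul_assoc, mul_smul_comm, map_smul, smul_eq_mul, mul_im, I_re, I_im, star_def,
    conj_I, neg_im, mul_re, zero_mul, zero_add, neg_mul, mul_neg] at hx hone hadd hI
  refine Complex.ext ?_ ?_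
  · rw [star_def, conj_re]
    linarith
  · rw [star_def, conj_im]
    linarith

/-- The algebra `Q` with the semi-inner product `⟪x, y⟫ = f (star x * y)`. -/
@[nolint unusedArguments]
def PreGNS (_f : PosFunctional Q) : Type u := Q

instance : AddCommGroup f.PreGNS := inferInstanceAs (AddCommGroup Q)

instance : Module ℂ f.PreGNS := inferInstanceAs (Module ℂ Q)

/-- The identity map `Q → f.PreGNS`. -/
def toPreGNS : Q ≃ₗ[ℂ] f.PreGNS := LinearEquiv.refl ℂ _

/-- The semi-inner product of a positive functional. -/
abbrev preInnerCore : PreInnerProductSpace.Core ℂ f.PreGNS where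
  inner a b := f.toLin (star (f.toPreGNS.symm a) * f.toPreGNS.symm b)
  conj_inner_symm a b := by
    rw [starRingEnd_apply, ← f.map_star, star_mul, star_star]
  re_inner_nonneg a := (Complex.nonneg_iff.1 (f.nonneg _)).1
  add_left a b c := by rw [map_add, star_add, add_mul, map_add]
  smul_left a b c := by simp

instance : SeminormedAddCommGroup f.PreGNS :=
  InnerProductSpace.Core.toSeminormedAddCommGroup (c := f.preInnerCore)

instance : InnerProductSpace ℂ f.PreGNS := InnerProductSpace.ofCore f.preInnerCore

theorem inner_def (a b : f.PreGNS) :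
    inner ℂ a b = f.toLin (star (f.toPreGNS.symm a) * f.toPreGNS.symm b) := rfl

theorem norm_toPreGNS_sq (x : Q) : ‖f.toPreGNS x‖ ^ 2 = (f.toLin (star x * x)).re :=
  norm_sq_eq_re_inner (𝕜 := ℂ) (f.toPreGNS x)

theorem ext_toPreGNS {S T : Completion f.PreGNS →L[ℂ] Completion f.PreGNS}
    (h : ∀ x : Q, S (f.toPreGNS x) = T (f.toPreGNS x)) : S = T := by
  ext ξ
  induction ξ using Completion.induction_on with
  | hp => exact isClosed_eq S.continuous T.continuous
  | ih x => exact h x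

end Algebraic

variable {Q : Type u} [NormedRing Q] [NormedAlgebra ℂ Q] [CompleteSpace Q] [StarRing Q]
  [StarModule ℂ Q] [NormedStarGroup Q] (f : PosFunctional Q)

theorem re_apply_star_mul_self_le (x y : Q) :
    (f.toLin (star (x * y) * (x * y))).re ≤
      (‖x‖ ^ 2 * ‖(1 : Q)‖ + 1) * (f.toLin (star y * y)).re := by
  set M : ℝ := ‖x‖ ^ 2 * ‖(1 : Q)‖ + 1
  have hM : ∀ z ∈ spectrum ℂ (star x * x), ‖z‖ < M := fun z hz => by
    have hle : ‖star x * x‖ ≤ ‖x‖ ^ 2 := (norm_mul_le _ _).trans_eq (by rw [norm_star, sq])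
    have := spectrum.norm_le_norm_mul_of_mem hz
    have := mul_le_mul_of_nonneg_right hle (norm_nonneg (1 : Q))
    linarith
  obtain ⟨u, hu, huu⟩ :=
    exists_isSelfAdjoint_mul_self_eq_algebraMap_sub (.star_mul_self x) (by positivity) hM
  have hsq : star (u * y) * (u * y) = M • (star y * y) - star (x * y) * (x * y) := by
    rw [star_mul, hu.star_eq, mul_assoc, ← mul_assoc u u, huu, Algebra.algebraMap_eq_smul_one]
    simp only [sub_mul, mul_sub, one_mul, smul_mul_assoc, mul_smul_comm, star_mul, mul_assoc]
  have hnonneg := (Complex.nonneg_iff.1 (f.nonneg (u * y))).1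
  rw [hsq, map_sub, ← Complex.coe_smul, map_smul, sub_re, smul_eq_mul, re_ofReal_mul] at hnonneg
  linarith

/-- Left multiplication by `x` on the pre-Hilbert space of `f`. -/
def leftMul (x : Q) : f.PreGNS →L[ℂ] f.PreGNS :=
  LinearMap.mkContinuous
    (f.toPreGNS.toLinearMap ∘ₗ LinearMap.mulLeft ℂ x ∘ₗ f.toPreGNS.symm.toLinearMap)
    √(‖x‖ ^ 2 * ‖(1 : Q)‖ + 1) fun y => by
      rw [← sq_le_sq₀ (norm_nonneg _) (by positivity), mul_pow, Real.sq_sqrt (by positivity)]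
      obtain ⟨y, rfl⟩ := f.toPreGNS.surjective y
      rw [norm_toPreGNS_sq]
      exact (f.norm_toPreGNS_sq (x * y)).trans_le (f.re_apply_star_mul_self_le x y)

theorem leftMul_apply (x : Q) (y : f.PreGNS) :
    f.leftMul x y = f.toPreGNS (x * f.toPreGNS.symm y) := rfl

/-- The GNS representation of a positive functional. -/
def gns : Q →⋆ₙₐ[ℂ] (Completion f.PreGNS →L[ℂ] Completion f.PreGNS) where
  toFun a := (f.leftMul a).completion
  map_smul' c a := f.ext_toPreGNS fun x => by
    simp [leftMul_apply, Completion.coe_smul]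
  map_zero' := f.ext_toPreGNS fun x => by
    simpa [leftMul_apply] using Completion.coe_zero
  map_add' a b := f.ext_toPreGNS fun x => by
    simp [leftMul_apply, add_mul, Completion.coe_add]
  map_mul' a b := f.ext_toPreGNS fun x => by
    simp [leftMul_apply, mul_assoc]
  map_star' a := by
    refine (ContinuousLinearMap.eq_adjoint_iff (f.leftMul (star a)).completion
      (f.leftMul a).completion).mpr fun x y => ?_
    induction x, y using Completion.induction_on₂ with
    | hp => apply isClosed_eq <;> fun_prop
    | ih x y => simp [leftMul_apply, mul_assoc, inner_def]

theorem gns_apply_toPreGNS (x y : Q) :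
    f.gns x (f.toPreGNS y : Completion f.PreGNS) = (f.toPreGNS (x * y) : Completion f.PreGNS) :=
  (f.leftMul x).completion_apply_coe (f.toPreGNS y)

end PosFunctional

/-- Raikov's theorem: apply the GNS construction to a state that vanishes at `star x * x`. -/
theorem IsSymmetric.exists_hilbertRep_apply_eq_zero {Q : Type u} [NormedRing Q] [NormedAlgebra ℂ Q]
    [CompleteSpace Q] [StarRing Q] [StarModule ℂ Q] [NormedStarGroup Q] (hQ : IsSymmetric Q)
    {x : Q} (hx : ¬ IsUnit (star x * x)) :
    ∃ (π : HilbertRep Q) (ξ : π.H), ξ ≠ 0 ∧ π.toHom 1 ξ = ξ ∧ π.toHom x ξ = 0 := by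
  obtain ⟨f, hone, hzero⟩ := hQ.exists_posFunctional (.star_mul_self x) hx
  refine ⟨{ H := Completion f.PreGNS, toHom := f.gns }, (f.toPreGNS 1 : Completion f.PreGNS),
    fun h => ?_, (f.gns_apply_toPreGNS 1 1).trans (by rw [mul_one]), ?_⟩
  · have hnorm := f.norm_toPreGNS_sq 1
    rw [← Completion.norm_coe, h] at hnorm
    simp [hone] at hnorm
  · refine (f.gns_apply_toPreGNS x 1).trans ?_
    rw [mul_one, ← norm_eq_zero, Completion.norm_coe, ← sq_eq_zero_iff, f.norm_toPreGNS_sq, hzero,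
      zero_re]

end GNS

/-! ### Quotients of Banach `*`-algebras -/

/-- A closed two-sided `*`-ideal of a unital Banach `*`-algebra. -/
structure ClosedStarIdeal (X : Type u) [NormedRing X] [Star X] where
  /-- The underlying (left) ideal. -/
  toIdeal : Ideal X
  isTwoSided : toIdeal.IsTwoSided
  isClosed : IsClosed (toIdeal : Set X)
  star_mem : ∀ x ∈ toIdeal, star x ∈ toIdeal

namespace ClosedStarIdeal

attribute [instance] isTwoSided isClosed

section Norm

variable {X : Type u} [NormedRing X] [Star X] (N : ClosedStarIdeal X)

/-- The quotient of a Banach `*`-algebra by a closed two-sided `*`-ideal, with the quotient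
norm and the induced involution. -/
abbrev Quot : Type u := X ⧸ N.toIdeal

theorem norm_mul_quot_le (p q : N.Quot) : ‖p * q‖ ≤ ‖p‖ * ‖q‖ := by
  have hlim : Filter.Tendsto (fun ε : ℝ => (‖p‖ + ε) * (‖q‖ + ε)) (nhdsWithin 0 (Set.Ioi 0))
      (nhds (‖p‖ * ‖q‖)) := by
    have : Continuous fun ε : ℝ => (‖p‖ + ε) * (‖q‖ + ε) := by fun_prop
    simpa only [add_zero] using (this.tendsto 0).mono_left nhdsWithin_le_nhds
  refine ge_of_tendsto hlim (Filter.eventually_of_mem self_mem_nhdsWithin fun ε hε => ?_)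
  obtain ⟨x, rfl, hx⟩ := Submodule.Quotient.norm_mk_lt p hε
  obtain ⟨y, rfl, hy⟩ := Submodule.Quotient.norm_mk_lt q hε
  calc _ ≤ ‖x * y‖ := Submodule.Quotient.norm_mk_le N.toIdeal (x * y)
    _ ≤ ‖x‖ * ‖y‖ := norm_mul_le x y
    _ ≤ _ := mul_le_mul hx.le hy.le (norm_nonneg y) ((norm_nonneg x).trans hx.le)

instance : NormedRing N.Quot :=
  { Submodule.Quotient.normedAddCommGroup N.toIdeal, Ideal.Quotient.ring N.toIdeal with
    norm_mul_le := N.norm_mul_quot_le }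

instance [NormedAlgebra ℂ X] : NormedAlgebra ℂ N.Quot :=
  { Submodule.Quotient.normedSpace N.toIdeal ℂ, Ideal.Quotient.algebra ℂ with }

end Norm

section Star

variable {X : Type u} [NormedRing X] [StarRing X] (N : ClosedStarIdeal X)

instance : Star N.Quot :=
  ⟨Quotient.lift (fun x => Ideal.Quotient.mk N.toIdeal (star x)) fun x y h => by
    rw [Ideal.Quotient.eq, ← star_sub]
    exact N.star_mem _ ((Submodule.quotientRel_def _).1 h)⟩

theorem mk_star (x : X) :
    Ideal.Quotient.mk N.toIdeal (star x) = star (Ideal.Quotient.mk N.toIdeal x) := rfl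

instance : StarRing N.Quot where
  star_involutive := Ideal.Quotient.mk_surjective.forall.2 fun x => by
    rw [← mk_star, ← mk_star, star_star]
  star_mul := Ideal.Quotient.mk_surjective.forall₂.2 fun x y => by
    rw [← map_mul, ← mk_star, ← mk_star, ← mk_star, ← map_mul, star_mul]
  star_add := Ideal.Quotient.mk_surjective.forall₂.2 fun x y => by
    rw [← map_add, ← mk_star, ← mk_star, ← mk_star, ← map_add, star_add]

variable [NormedAlgebra ℂ X]

theorem mk_smul (c : ℂ) (x : X) :
    Ideal.Quotient.mk N.toIdeal (c • x) = c • Ideal.Quotient.mk N.toIdeal x := rfl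

instance [StarModule ℂ X] : StarModule ℂ N.Quot where
  star_smul c := Ideal.Quotient.mk_surjective.forall.2 fun x => by
    rw [← mk_smul, ← mk_star, ← mk_star, star_smul, mk_smul]

instance [NormedStarGroup X] : NormedStarGroup N.Quot where
  norm_star_le q := le_of_forall_pos_le_add fun ε hε => by
    obtain ⟨x, rfl, hx⟩ := Submodule.Quotient.norm_mk_lt q hε
    calc _ ≤ ‖star x‖ := Submodule.Quotient.norm_mk_le N.toIdeal (star x)
      _ ≤ _ := (norm_star x).trans_le hx.le

/-- The quotient map as a `*`-homomorphism. -/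
def proj : X →⋆ₐ[ℂ] N.Quot :=
  { Ideal.Quotient.mkₐ ℂ N.toIdeal with map_star' := N.mk_star }

theorem proj_surjective : Function.Surjective N.proj := Ideal.Quotient.mk_surjective

theorem proj_eq_zero_iff {x : X} : N.proj x = 0 ↔ x ∈ N.toIdeal := Ideal.Quotient.eq_zero_iff_mem

theorem exists_hilbertRep [CompleteSpace X] [StarModule ℂ X] [NormedStarGroup X]
    (hN : IsSymmetric N.Quot) {x : X} (hx : ∀ y, y * x - 1 ∉ N.toIdeal) :
    ∃ (π : HilbertRep X) (ξ : π.H), ξ ≠ 0 ∧ π.toHom 1 ξ = ξ ∧ π.toHom x ξ = 0 ∧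
      ∀ y ∈ N.toIdeal, π.toHom y = 0 := by
  have hunit : ¬ IsUnit (star (N.proj x) * N.proj x) := by
    rintro ⟨u, hu⟩
    obtain ⟨y, hy⟩ := N.proj_surjective (↑u⁻¹ : N.Quot)
    refine hx (y * star x) (N.proj_eq_zero_iff.1 ?_)
    rw [map_sub, map_mul, map_mul, map_one, map_star, mul_assoc, ← hu, hy, u.inv_mul, sub_self]
  obtain ⟨π, ξ, hξ, hone, hzero⟩ := hN.exists_hilbertRep_apply_eq_zero hunit
  refine ⟨⟨π.H, π.toHom.comp (N.proj : X →⋆ₙₐ[ℂ] N.Quot)⟩, ξ, hξ, ?_, hzero, fun y hy => ?_⟩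
  · simpa using hone
  · simp [N.proj_eq_zero_iff.2 hy]

end Star

end ClosedStarIdeal

/-! ### Permanence of symmetry -/

section Permanence

theorem nonneg_of_frontier_nonneg {s : Set ℂ} (hs : IsCompact s)
    (h : ∀ z ∈ frontier s, 0 ≤ z.re ∧ z.im = 0) : ∀ z ∈ s, 0 ≤ z.re ∧ z.im = 0 := by
  set t : Set ℂ := Neg.neg ⁻¹' Complex.slitPlane with ht
  have mem_t (z : ℂ) : z ∈ t ↔ ¬ (0 ≤ z.re ∧ z.im = 0) := by
    rw [not_and_or, not_le]
    simp [ht, Complex.mem_slitPlane_iff]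
  have hconn : IsPreconnected t := by
    rw [ht, Set.neg_preimage, ← Set.image_neg_eq_neg]
    exact (Complex.starConvex_one_slitPlane.isPathConnected
      Complex.one_mem_slitPlane).isConnected.isPreconnected.image _ continuous_neg.continuousOn
  have hcover : t ⊆ interior s ∪ sᶜ := fun z hz => by
    by_contra hzs
    rw [Set.mem_union, not_or, Set.mem_compl_iff, not_not] at hzs
    exact (mem_t z).1 hz (h z ⟨subset_closure hzs.2, hzs.1⟩)
  have hdisj : Disjoint (interior s) sᶜ := disjoint_compl_right.mono_left interior_subset
  rcases hconn.subset_or_subset isOpen_interior hs.isClosed.isOpen_compl hdisj hcover with hts | hts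
  · obtain ⟨C, hC, hsC⟩ := hs.isBounded.exists_pos_norm_le
    have hmem : (-(C + 1 : ℝ) : ℂ) ∈ t := (mem_t _).2 (by simp; linarith)
    have := hsC _ (interior_subset (hts hmem))
    rw [norm_neg, Complex.norm_real, Real.norm_of_nonneg (by linarith)] at this
    linarith
  · exact fun z hz => not_not.1 fun hz' => hts ((mem_t z).2 hz') hz

theorem spectrum_nonneg_of_injective {A B : Type*} [Ring A] [Algebra ℂ A] [NormedRing B]
    [NormedAlgebra ℂ B] [CompleteSpace B] (F : A →ₐ[ℂ] B) (hF : Function.Injective F)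
    (hcl : IsClosed (Set.range F)) {a : A} (ha : ∀ z ∈ spectrum ℂ (F a), 0 ≤ z.re ∧ z.im = 0) :
    ∀ z ∈ spectrum ℂ a, 0 ≤ z.re ∧ z.im = 0 := by
  have hcl' : IsClosed (F.range : Set B) := by rwa [AlgHom.coe_range]
  have : CompleteSpace F.range := hcl'.completeSpace_coe
  rw [← AlgEquiv.spectrum_eq (AlgEquiv.ofInjective F hF) a]
  exact nonneg_of_frontier_nonneg (spectrum.isCompact _) fun z hz =>
    ha z (Subalgebra.frontier_spectrum F.range _ hz)

variable {L : Type*} [NonUnitalNormedRing L] [NormedSpace ℂ L]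

theorem continuous_unitization_snd :
    Continuous fun l : WithLp 1 (Unitization ℂ L) => (WithLp.ofLp l).snd := by
  refine (LipschitzWith.of_dist_le_mul (K := 1) fun l m => ?_).continuous
  rw [dist_eq_norm, dist_eq_norm, NNReal.coe_one, one_mul, WithLp.unitization_norm_def]
  exact le_add_of_nonneg_left (norm_nonneg _)

theorem isClosed_range_of_controlled_lift {X : Type*} [NonUnitalNormedRing X] [NormedSpace ℂ X]
    [CompleteSpace X] (Φ : X →ₙₐ[ℂ] L) {C : ℝ} (hC : 0 < C) (hΦ : ∀ x, ‖Φ x‖ ≤ C * ‖x‖)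
    (hlift : ∀ x, ∃ x', Φ x' = Φ x ∧ ‖x'‖ ≤ C * ‖Φ x‖) : IsClosed (Set.range Φ) := by
  let f : NormedAddGroupHom X L := AddMonoidHom.mkNormedAddGroupHom Φ C hΦ
  have hsurj : f.SurjectiveOnWith f.range C := by
    rintro _ ⟨x, rfl⟩
    exact hlift x
  have hclosure := controlled_closure_of_complete hC one_pos hsurj
  refine isClosed_of_closure_subset fun l hl => ?_
  obtain ⟨x, hx, -⟩ := hclosure l hl
  exact ⟨x, hx⟩

variable [IsScalarTower ℂ L L] [SMulCommClass ℂ L L]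

/-- The inclusion of the unitization of a subalgebra of `L` into the unitization of `L`, normed
by the `ℓ¹`-norm. -/
def unitizationInclusion (D : NonUnitalSubalgebra ℂ L) :
    Unitization ℂ D →ₐ[ℂ] WithLp 1 (Unitization ℂ L) :=
  ((WithLp.unitizationAlgEquiv (𝕜 := ℂ) (A := L) ℂ).symm : _ →ₐ[ℂ] _).comp
    (Unitization.lift ((Unitization.inrNonUnitalAlgHom ℂ L).comp
      (NonUnitalSubalgebraClass.subtype D)))

theorem ofLp_unitizationInclusion (D : NonUnitalSubalgebra ℂ L) (d : Unitization ℂ D) :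
    WithLp.ofLp (unitizationInclusion D d) = .inl d.fst + .inr (d.snd : L) := rfl

theorem unitizationInclusion_injective (D : NonUnitalSubalgebra ℂ L) :
    Function.Injective (unitizationInclusion D) := fun d e h => by
  have h' := congrArg WithLp.ofLp h
  rw [ofLp_unitizationInclusion, ofLp_unitizationInclusion] at h'
  ext
  · simpa using congrArg (fun l => l.fst) h'
  · simpa using congrArg (fun l => l.snd) h'

theorem range_unitizationInclusion (D : NonUnitalSubalgebra ℂ L) :
    Set.range (unitizationInclusion D) = {l | (WithLp.ofLp l).snd ∈ D} := by
  ext l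
  constructor
  · rintro ⟨d, rfl⟩
    simp [ofLp_unitizationInclusion]
  · intro hl
    refine ⟨.inl (WithLp.ofLp l).fst + .inr ⟨(WithLp.ofLp l).snd, hl⟩,
      WithLp.ofLp_injective 1 ?_⟩
    simp [ofLp_unitizationInclusion, Unitization.inl_fst_add_inr_snd_eq]

variable [CompleteSpace L]

theorem quasispectrum_nonneg_of_isClosed {D : NonUnitalSubalgebra ℂ L}
    (hD : IsClosed (D : Set L)) {d : D}
    (hd : ∀ z ∈ quasispectrum ℂ (d : L), 0 ≤ z.re ∧ z.im = 0) :
    ∀ z ∈ quasispectrum ℂ d, 0 ≤ z.re ∧ z.im = 0 := by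
  rw [Unitization.quasispectrum_eq_spectrum_inr]
  refine spectrum_nonneg_of_injective _ (unitizationInclusion_injective D) ?_ ?_
  · rw [range_unitizationInclusion]
    exact hD.preimage continuous_unitization_snd
  · have : unitizationInclusion D (d : Unitization ℂ D) =
        (WithLp.unitizationAlgEquiv (𝕜 := ℂ) (A := L) ℂ).symm ((d : L) : Unitization ℂ L) :=
      WithLp.ofLp_injective 1 (by simp [ofLp_unitizationInclusion, Unitization.inl_zero])
    rwa [this, AlgEquiv.spectrum_eq, ← Unitization.quasispectrum_eq_spectrum_inr]

theorem quasispectrum_subset_of_ker_le {X D Q : Type*} [NonUnitalRing X] [Module ℂ X]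
    [NonUnitalRing D] [Module ℂ D] [NonUnitalRing Q] [Module ℂ Q] (φ : X →ₙₐ[ℂ] D)
    (ψ : X →ₙₐ[ℂ] Q) (hφ : Function.Surjective φ) (hker : ∀ x, φ x = 0 → ψ x = 0) (x : X) :
    quasispectrum ℂ (ψ x) ⊆ quasispectrum ℂ (φ x) := by
  intro z hz hunit hreg
  refine hz hunit ?_
  rw [isQuasiregular_iff] at hreg ⊢
  obtain ⟨d, hleft, hright⟩ := hreg
  obtain ⟨y, rfl⟩ := hφ d
  simp only [Units.smul_def, ← map_smul, ← map_neg, ← map_add, ← map_mul] at hleft hright ⊢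
  exact ⟨ψ y, by simpa only [map_add, map_mul] using hker _ hleft,
    by simpa only [map_add, map_mul] using hker _ hright⟩

theorem IsSymmetric.of_controlled_lift [Star L] (hL : IsSymmetric L) {X Q : Type*}
    [NonUnitalNormedRing X] [NormedSpace ℂ X] [Star X] [CompleteSpace X] [NonUnitalRing Q]
    [Module ℂ Q] [Star Q] (Φ : X →⋆ₙₐ[ℂ] L) {C : ℝ} (hC : 0 < C) (hΦ : ∀ x, ‖Φ x‖ ≤ C * ‖x‖)
    (hlift : ∀ x, ∃ x', Φ x' = Φ x ∧ ‖x'‖ ≤ C * ‖Φ x‖) (ψ : X →⋆ₙₐ[ℂ] Q)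
    (hψ : Function.Surjective ψ) (hker : ∀ x, Φ x = 0 → ψ x = 0) : IsSymmetric Q := by
  let D : NonUnitalSubalgebra ℂ L := NonUnitalAlgHom.range (Φ : X →ₙₐ[ℂ] L)
  let φ : X →ₙₐ[ℂ] D := NonUnitalAlgHom.rangeRestrict (Φ : X →ₙₐ[ℂ] L)
  have hD : IsClosed (D : Set L) := by
    simpa [D] using isClosed_range_of_controlled_lift (Φ : X →ₙₐ[ℂ] L) hC hΦ hlift
  intro q z hz
  obtain ⟨x, rfl⟩ := hψ q
  rw [← map_star, ← map_mul] at hz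
  refine quasispectrum_nonneg_of_isClosed hD (d := φ (star x * x)) ?_ z
    (quasispectrum_subset_of_ker_le φ (ψ : X →ₙₐ[ℂ] Q)
      (fun ⟨_, x, hx⟩ => ⟨x, Subtype.ext hx⟩) (fun x hx => hker x (congrArg Subtype.val hx))
      _ hz)
  have : (φ (star x * x) : L) = star (Φ x) * Φ x := by
    rw [← map_star, ← map_mul]; rfl
  rw [this]
  exact hL (Φ x)

end Permanence

/-! ### Point masses and the unit of the twisted `ℓ¹`-algebra -/

namespace L1

section Single

variable {G : Type u} [Group G] {A : Type v} [NormedAddCommGroup A] [NormedSpace ℂ A]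
  (S : FiberStructure G A)

open Classical in
/-- The point mass at `x`, as a bounded linear function of its value. -/
def single (x : G) : A →L[ℂ] L1 S := lp.singleContinuousLinearMap ℂ (fun _ => A) 1 x

@[simp] theorem single_self (x : G) (a : A) : single S x a x = a := by
  classical exact lp.single_apply_self (E := fun _ => A) 1 x a

theorem single_of_ne {x y : G} (h : y ≠ x) (a : A) : single S x a y = 0 := by
  classical exact lp.single_apply_ne (E := fun _ => A) 1 x a h

theorem norm_single (x : G) (a : A) : ‖single S x a‖ = ‖a‖ := by
  classical exact lp.norm_single (E := fun _ => A) one_pos x a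

variable {S}

theorem hasSum_single (f : L1 S) : HasSum (fun x => single S x (f x)) f := by
  classical exact lp.hasSum_single (p := 1) ENNReal.one_ne_top (show lp (fun _ : G => A) 1 from f)

variable [CompleteSpace A]

theorem single_mul_apply (x : G) (a : A) (f : L1 S) (y : G) :
    (single S x a * f) y = S.mul x (x⁻¹ * y) a (f (x⁻¹ * y)) := by
  rw [mul_apply, tsum_eq_single x, single_self]
  intro z hz
  rw [single_of_ne S hz, map_zero, _root_.zero_apply]

variable (S)

theorem single_mul_single (x y : G) (a b : A) :
    single S x a * single S y b = single S (x * y) (S.mul x y a b) := by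
  refine ext fun z => ?_
  rw [single_mul_apply]
  rcases eq_or_ne z (x * y) with rfl | h
  · rw [single_self, inv_mul_cancel_left, single_self]
  · rw [single_of_ne S h, single_of_ne S (mt inv_mul_eq_iff_eq_mul.1 h), map_zero]

theorem star_single (x : G) (a : A) : star (single S x⁻¹ a) = single S x (S.inv x a) := by
  refine ext fun z => ?_
  rw [star_apply]
  rcases eq_or_ne z x with rfl | h
  · rw [single_self, single_self]
  · rw [single_of_ne S h, single_of_ne S (inv_injective.ne h), map_zero]

end Single

end L1

namespace TwistedAction

open L1

variable {G : Type u} [Group G] {A : Type v} [CStarAlgebra A] (S : TwistedAction G A)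

theorem α_one (a : A) : S.α 1 a = a := by
  apply (S.α 1).injective
  simpa [S.ω_one_left] using S.α_comp 1 1 a

theorem α_ω_inv (x : G) : S.α x (S.ω x⁻¹ x : A) = (S.ω x x⁻¹ : A) := by
  simpa [S.ω_one_left, S.ω_one_right] using (S.cocycle x x⁻¹ x).symm

theorem fibers_mul (x y : G) (a b : A) : S.fibers.mul x y a b = a * S.α x b * (S.ω x y : A) := rfl

theorem fibers_inv (x : G) (a : A) :
    S.fibers.inv x a = star (S.ω x x⁻¹ : A) * star (S.α x a) := rfl

theorem single_one_mul (f : S.TwistedL1) : single S.fibers 1 1 * f = f := by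
  refine ext fun x => ?_
  rw [single_mul_apply, fibers_mul, inv_one, one_mul, one_mul, S.α_one, S.ω_one_left,
    OneMemClass.coe_one, mul_one]

theorem mul_single_one (f : S.TwistedL1) : f * single S.fibers 1 1 = f := by
  refine ext fun x => ?_
  rw [S.twisted_mul_apply, tsum_eq_single x fun y hy => ?_]
  · simp [S.ω_one_right]
  · rw [single_of_ne _ (mt inv_mul_eq_one.1 hy), map_zero, mul_zero, zero_mul]

instance : NormedRing S.TwistedL1 :=
  { (inferInstance : NonUnitalNormedRing S.TwistedL1) with
    one := single S.fibers 1 1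
    one_mul := S.single_one_mul
    mul_one := S.mul_single_one }

instance : NormedAlgebra ℂ S.TwistedL1 :=
  { (inferInstance : NormedSpace ℂ S.TwistedL1),
    Algebra.ofModule smul_mul_assoc mul_smul_comm with }

theorem single_one_mul_single (x : G) (a : A) :
    single S.fibers 1 a * single S.fibers x 1 = single S.fibers x a := by
  rw [single_mul_single, fibers_mul, one_mul, map_one, mul_one, S.ω_one_left,
    OneMemClass.coe_one, mul_one]

theorem single_mul_star_single (x : G) (a : A) :
    single S.fibers x a * star (single S.fibers x 1) = single S.fibers 1 a := by
  have hstar : star (single S.fibers x 1) = single S.fibers x⁻¹ (S.fibers.inv x⁻¹ 1) := by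
    rw [← star_single, inv_inv]
  rw [hstar, single_mul_single, fibers_mul, fibers_inv, mul_inv_cancel, inv_inv, map_one, star_one,
    mul_one, map_star, S.α_ω_inv, mul_assoc, S.star_ω_mul, mul_one]

/-- The inclusion of the coefficient algebra. -/
def coeffHom : A →⋆ₙₐ[ℂ] S.TwistedL1 :=
  { (single S.fibers 1 : A →ₗ[ℂ] S.TwistedL1) with
    map_zero' := map_zero (single S.fibers 1)
    map_mul' := fun a b => by
      simp [single_mul_single, fibers_mul, S.α_one, S.ω_one_left]
    map_star' := fun a => by
      simpa [fibers_inv, S.α_one, S.ω_one_left] using (star_single S.fibers 1 a).symm }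

theorem coeffHom_apply (a : A) : S.coeffHom a = single S.fibers 1 a := rfl

end TwistedAction

/-! ### Lifting along `*`-homomorphisms -/

section Lift

variable {A : Type v} [NonUnitalCStarAlgebra A] {B : Type w} [NonUnitalCStarAlgebra B]

theorem exists_lift_of_isSelfAdjoint (θ : A →⋆ₙₐ[ℂ] B) {a : A} (ha : IsSelfAdjoint a) :
    ∃ a', θ a' = θ a ∧ ‖a'‖ ≤ ‖θ a‖ := by
  set r := ‖θ a‖
  have hr : 0 ≤ r := norm_nonneg _
  set clip : ℝ → ℝ := fun t => max (-r) (min t r) with hclip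
  have clip_of_abs_le {t : ℝ} (ht : |t| ≤ r) : clip t = t := by
    simp [hclip, (abs_le.1 ht).1, (abs_le.1 ht).2]
  have abs_clip_le (t : ℝ) : |clip t| ≤ r :=
    abs_le.2 ⟨le_max_left _ _, max_le (by linarith) (min_le_right _ _)⟩
  have hcont : Continuous clip := by fun_prop
  have hθ : Continuous θ := by
    open scoped CStarAlgebra in exact map_continuous θ
  refine ⟨cfcₙ clip a, ?_, norm_cfcₙ_le fun t _ => abs_clip_le t⟩
  rw [NonUnitalStarAlgHomClass.map_cfcₙ (S := ℂ) θ clip a hcont.continuousOn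
    (clip_of_abs_le (by simpa using hr)) hθ ha (ha.map θ)]
  refine (cfcₙ_congr fun t ht => clip_of_abs_le ?_).trans (cfcₙ_id' ℝ (θ a) (ha.map θ))
  exact NonUnitalIsometricContinuousFunctionalCalculus.norm_quasispectrum_le (𝕜 := ℝ) (θ a) ht
    (ha.map θ)

theorem exists_lift_norm_le (θ : A →⋆ₙₐ[ℂ] B) (a : A) :
    ∃ a', θ a' = θ a ∧ ‖a'‖ ≤ 2 * ‖θ a‖ := by
  obtain ⟨x, hx, hx'⟩ := exists_lift_of_isSelfAdjoint θ (realPart a).2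
  obtain ⟨y, hy, hy'⟩ := exists_lift_of_isSelfAdjoint θ (imaginaryPart a).2
  rw [map_realPart θ a] at hx hx'
  rw [map_imaginaryPart θ a] at hy hy'
  refine ⟨x + Complex.I • y, ?_, ?_⟩
  · rw [map_add, map_smul, hx, hy, realPart_add_I_smul_imaginaryPart]
  · calc ‖x + Complex.I • y‖ ≤ ‖x‖ + ‖Complex.I • y‖ := norm_add_le _ _
      _ = ‖x‖ + ‖y‖ := by rw [norm_smul, Complex.norm_I, one_mul]
      _ ≤ ‖θ a‖ + ‖θ a‖ :=
        add_le_add (hx'.trans (realPart.norm_le (θ a))) (hy'.trans (imaginaryPart.norm_le (θ a)))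
      _ = 2 * ‖θ a‖ := (two_mul _).symm

end Lift

/-! ### Symmetry of the twisted `ℓ¹`-algebra modulo the kernel of its representations -/

section Family

variable {𝔅 : Type u} [NonUnitalNormedRing 𝔅] [StarRing 𝔅] [NormedStarGroup 𝔅] [CompleteSpace 𝔅]
  [NormedSpace ℂ 𝔅] [IsScalarTower ℂ 𝔅 𝔅] [SMulCommClass ℂ 𝔅 𝔅] [StarModule ℂ 𝔅]

theorem continuous_hom {D : Type*} [NonUnitalCStarAlgebra D] (φ : 𝔅 →⋆ₙₐ[ℂ] D) :
    Continuous φ :=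
  AddMonoidHomClass.continuous_of_bound φ 1 fun b => by simpa using norm_hom_le φ b

/-- The direct sum of a family of representations. -/
def familyRep {ι : Type u} (F : ι → HilbertRep 𝔅) :
    𝔅 →⋆ₙₐ[ℂ] lp (fun i => (F i).H →L[ℂ] (F i).H) ∞ where
  toFun b := ⟨fun i => (F i).toHom b,
    memℓp_infty ⟨‖b‖, by rintro _ ⟨i, rfl⟩; exact norm_hom_le (F i).toHom b⟩⟩
  map_smul' c b := lp.ext (funext fun i => map_smul (F i).toHom c b)
  map_zero' := lp.ext (funext fun i => map_zero (F i).toHom)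
  map_add' a b := lp.ext (funext fun i => map_add (F i).toHom a b)
  map_mul' a b := lp.ext (funext fun i => map_mul (F i).toHom a b)
  map_star' b := lp.ext (funext fun i => map_star (F i).toHom b)

theorem apply_eq_zero_of_familyRep_eq_zero {ι : Type u} {F : ι → HilbertRep 𝔅} {b : 𝔅}
    (hb : familyRep F b = 0) (i : ι) : (F i).toHom b = 0 :=
  congrFun (congrArg Subtype.val hb) i

theorem toEnveloping_eq_zero {b : 𝔅} (hb : ∀ π : HilbertRep 𝔅, π.toHom b = 0) :
    toEnveloping 𝔅 b = 0 :=
  Subtype.ext (lp.ext (funext hb))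

variable (𝔅) in
/-- The enveloping `C^*`-algebra lives in a larger universe than `𝔅`, so it cannot serve as the
coefficient algebra in the definition of rigid symmetry. One representation for each element of `𝔅`
that survives in some representation is enough to replace it. -/
theorem exists_faithful_on_enveloping :
    ∃ (B : Type u) (_ : NonUnitalCStarAlgebra B) (ρ : 𝔅 →⋆ₙₐ[ℂ] B),
      ∀ b, ρ b = 0 → toEnveloping 𝔅 b = 0 := by
  choose F hF using fun b : {b : 𝔅 // ∃ π : HilbertRep 𝔅, π.toHom b ≠ 0} => b.2
  refine ⟨_, inferInstance, familyRep F, fun b hb => toEnveloping_eq_zero fun π => ?_⟩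
  by_contra hπ
  exact hF ⟨b, π, hπ⟩ (apply_eq_zero_of_familyRep_eq_zero hb ⟨b, π, hπ⟩)

end Family

theorem norm_one_le_one (A : Type*) [CStarAlgebra A] : ‖(1 : A)‖ ≤ 1 := by
  rcases subsingleton_or_nontrivial A with _ | _
  · simp [Subsingleton.elim (1 : A) 0]
  · exact CStarRing.norm_one.le

namespace TwistedAction

open L1

variable {G : Type u} [Group G] {A : Type v} [CStarAlgebra A] (S : TwistedAction G A)
  {B : Type w} [NonUnitalCStarAlgebra B] (ρ : S.TwistedL1 →⋆ₙₐ[ℂ] B)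

theorem norm_apply_single_le (x : G) (a : A) : ‖ρ (single S.fibers x a)‖ ≤ ‖a‖ :=
  (norm_hom_le ρ _).trans_eq (norm_single _ x a)

/-- Multiplying by the unitary `single x 1` moves the point mass to the unit of the group, where
the lifting property of `*`-homomorphisms of `C^*`-algebras applies. -/
theorem exists_lift_single (x : G) (a : A) :
    ∃ a', ρ (single S.fibers x a') = ρ (single S.fibers x a) ∧
      ‖a'‖ ≤ 2 * ‖ρ (single S.fibers x a)‖ := by
  obtain ⟨a', hlift, hnorm⟩ := exists_lift_norm_le (ρ.comp S.coeffHom) a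
  simp only [NonUnitalStarAlgHom.comp_apply, coeffHom_apply] at hlift hnorm
  refine ⟨a', ?_, hnorm.trans (mul_le_mul_of_nonneg_left ?_ zero_le_two)⟩
  · rw [← S.single_one_mul_single x a', ← S.single_one_mul_single x a, map_mul, map_mul, hlift]
  · calc ‖ρ (single S.fibers 1 a)‖
        ≤ ‖ρ (single S.fibers x a)‖ * ‖ρ (star (single S.fibers x 1))‖ := by
          rw [← S.single_mul_star_single x a, map_mul]
          exact norm_mul_le _ _
      _ ≤ ‖ρ (single S.fibers x a)‖ := by
          refine mul_le_of_le_one_right (norm_nonneg _) ?_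
          rw [map_star, norm_star]
          exact (S.norm_apply_single_le ρ x 1).trans (norm_one_le_one A)

theorem summable_norm_apply_single (f : S.TwistedL1) :
    Summable fun x => ‖ρ (single S.fibers x (f x))‖ :=
  (summable_norm f).of_nonneg_of_le (fun _ => norm_nonneg _)
    fun x => S.norm_apply_single_le ρ x (f x)

theorem tsum_apply_single_mul (f g : S.TwistedL1) (x : G) :
    ∑' y, ρ (single S.fibers y (f y)) * ρ (single S.fibers (y⁻¹ * x) (g (y⁻¹ * x))) =
      ρ (single S.fibers x ((f * g) x)) := by
  have h := ((summable_conv f g x).hasSum.mapL (single S.fibers x)).map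
    (ρ : S.TwistedL1 →+ B) (continuous_hom ρ)
  rw [mul_apply]
  refine (tsum_congr fun y => ?_).trans h.tsum_eq
  rw [← map_mul, single_mul_single, mul_inv_cancel_left]
  rfl

/-- A `*`-homomorphism `ρ` of the graded algebra `ℓ¹_{α,ω}(G; A)` into a `C^*`-algebra `B` induces
the diagonal `*`-homomorphism into `ℓ¹(G; B)`, which applies `ρ` in each degree. -/
def diagonal : S.TwistedL1 →⋆ₙₐ[ℂ] L1 (plainFibers G B) where
  toFun f := L1.mk (fun x => ρ (single S.fibers x (f x))) (S.summable_norm_apply_single ρ f)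
  map_smul' c f := ext fun x => by
    rw [mk_apply, L1.smul_apply, map_smul, map_smul]
    rfl
  map_zero' := ext fun x => by rw [mk_apply, L1.zero_apply, map_zero, map_zero, L1.zero_apply]
  map_add' f g := ext fun x => by
    rw [mk_apply, L1.add_apply, map_add, map_add]
    rfl
  map_mul' f g := ext fun x => by
    rw [mk_apply, plain_mul_apply, ← S.tsum_apply_single_mul ρ f g x]
    rfl
  map_star' f := ext fun x => by
    rw [mk_apply, star_apply, plain_star_apply, mk_apply, ← map_star, star_single]

theorem norm_diagonal_le (f : S.TwistedL1) : ‖S.diagonal ρ f‖ ≤ ‖f‖ := by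
  rw [norm_eq, norm_eq]
  exact (summable_norm _).tsum_le_tsum (fun x => S.norm_apply_single_le ρ x (f x))
    (summable_norm f)

theorem exists_lift_diagonal (f : S.TwistedL1) :
    ∃ f', S.diagonal ρ f' = S.diagonal ρ f ∧ ‖f'‖ ≤ 2 * ‖S.diagonal ρ f‖ := by
  choose g hg hnorm using fun x => S.exists_lift_single ρ x (f x)
  have hsum : Summable fun x => 2 * ‖S.diagonal ρ f x‖ := (summable_norm _).mul_left 2
  have hgsum : Summable fun x => ‖g x‖ := hsum.of_nonneg_of_le (fun _ => norm_nonneg _) hnorm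
  refine ⟨L1.mk g hgsum, ext hg, ?_⟩
  rw [norm_eq, norm_eq, ← tsum_mul_left]
  exact hgsum.tsum_le_tsum hnorm hsum

theorem apply_eq_zero_of_diagonal_eq_zero {f : S.TwistedL1} (hf : S.diagonal ρ f = 0) :
    ρ f = 0 := by
  refine ((hasSum_single f).map (ρ : S.TwistedL1 →+ B) (continuous_hom ρ)).unique ?_
  convert! hasSum_zero using 2 with x
  exact congrArg (fun g : L1 (plainFibers G B) => g x) hf

variable {S}

theorem isSymmetric_quot (hG : RigidlySymmetric.{u, max u v} G) (N : ClosedStarIdeal S.TwistedL1)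
    (hN : ∀ f, S.toCrossedProduct f = 0 → f ∈ N.toIdeal) : IsSymmetric N.Quot := by
  obtain ⟨B, _, ρ, hρ⟩ := exists_faithful_on_enveloping S.TwistedL1
  exact (hG B).of_controlled_lift (S.diagonal ρ) zero_lt_two
    (fun f => (S.norm_diagonal_le ρ f).trans (le_mul_of_one_le_left (norm_nonneg f) one_le_two))
    (S.exists_lift_diagonal ρ) (N.proj : S.TwistedL1 →⋆ₙₐ[ℂ] N.Quot) N.proj_surjective
    fun f hf => N.proj_eq_zero_iff.2 (hN f (hρ f (S.apply_eq_zero_of_diagonal_eq_zero ρ hf)))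

end TwistedAction

/-! ### Compact and Fredholm operators -/

section Operators

variable {H : Type*} [NormedAddCommGroup H] [InnerProductSpace ℂ H]

theorem isCompactOperator_of_finiteDimensional_range {T : H →L[ℂ] H}
    [FiniteDimensional ℂ T.range] : IsCompactOperator T := by
  have hid : IsCompactOperator (id : T.range → T.range) :=
    (isCompactOperator_id_iff_finiteDimensional (𝕜 := ℂ)).2 inferInstance
  exact (hid.comp_clm T.rangeRestrict).clm_comp T.range.subtypeL

theorem isCompactOperator_rankOne (x y : H) :
    IsCompactOperator (InnerProductSpace.rankOne ℂ x y : H →L[ℂ] H) := by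
  have hrange : (InnerProductSpace.rankOne ℂ x y : H →L[ℂ] H).range ≤ ℂ ∙ x := by
    rintro _ ⟨z, rfl⟩
    exact Submodule.smul_mem _ _ (Submodule.mem_span_singleton_self x)
  have := Submodule.finiteDimensional_of_le hrange
  exact isCompactOperator_of_finiteDimensional_range

theorem eq_one_of_mul_compact_eq {P : H →L[ℂ] H}
    (hP : ∀ K : H →L[ℂ] H, IsCompactOperator K → P * K = K) : P = 1 := by
  ext x
  rcases eq_or_ne x 0 with rfl | hx
  · simp
  have h : inner ℂ x x • P x = inner ℂ x x • x := by
    simpa using congrArg (fun T : H →L[ℂ] H => T x) (hP _ (isCompactOperator_rankOne x x))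
  exact smul_right_injective H (inner_self_ne_zero (𝕜 := ℂ).2 hx) h

theorem exists_parametrix {T : H →L[ℂ] H} (hT : T.IsFredholm) :
    ∃ V K L : H →L[ℂ] H, IsCompactOperator K ∧ IsCompactOperator L ∧
      V * T = 1 + K ∧ T * V = 1 + L := by
  obtain ⟨V, hl, hr⟩ := hT.exists_isQuasiInverse
  have : IsNoetherian ℂ (V * T - 1 : H →L[ℂ] H).range :=
    LinearMap.FiniteRangeSetoid.equiv_iff_hasNoetherianRange.1 hl
  have : IsNoetherian ℂ (T * V - 1 : H →L[ℂ] H).range :=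
    LinearMap.FiniteRangeSetoid.equiv_iff_hasNoetherianRange.1 hr
  exact ⟨V, V * T - 1, T * V - 1, isCompactOperator_of_finiteDimensional_range,
    isCompactOperator_of_finiteDimensional_range, by abel, by abel⟩

theorem exists_mul_eq_one_add_compact {T V W C L : H →L[ℂ] H} (hC : IsCompactOperator C)
    (hL : IsCompactOperator L) (hWT : W * T = 1 + C) (hTV : T * V = 1 + L) :
    ∃ L' : H →L[ℂ] H, IsCompactOperator L' ∧ T * W = 1 + L' := by
  refine ⟨L + T * C * V - T * W * L, ?_, ?_⟩
  · exact (hL.add ((hC.clm_comp T).comp_clm V)).sub (IsCompactOperator.clm_comp hL (T * W))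
  · have h : T * W * (T * V) = T * (W * T) * V := by simp only [mul_assoc]
    rw [hTV, hWT, mul_add, mul_add, add_mul, mul_one, mul_one, hTV] at h
    exact (eq_sub_of_add_eq h).trans (by abel)

variable [CompleteSpace H]

theorem norm_star_apply_sq_le (T : H →L[ℂ] H) (x : H) :
    ‖star T x‖ ^ 2 ≤ ‖(T * star T) x‖ * ‖x‖ := by
  rw [ContinuousLinearMap.apply_norm_sq_eq_inner_adjoint_left,
    ← ContinuousLinearMap.star_eq_adjoint, star_star]
  exact re_inner_le_norm _ _

theorem isCompactOperator_star {T : H →L[ℂ] H} (hT : IsCompactOperator T) :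
    IsCompactOperator (star T : H →L[ℂ] H) := by
  have hTT : IsCompactOperator (T * star T : H →L[ℂ] H) := hT.comp_clm (star T)
  have htot : TotallyBounded ((T * star T : H →L[ℂ] H) '' Metric.ball 0 1) :=
    (hTT.isCompact_closure_image_ball (f := ((T * star T : H →L[ℂ] H) : H →ₗ[ℂ] H))
      1).totallyBounded.subset subset_closure
  refine (isCompactOperator_iff_isCompact_closure_image_ball
    ((star T : H →L[ℂ] H) : H →ₗ[ℂ] H) one_pos).2
    (TotallyBounded.isCompact_of_isClosed (TotallyBounded.closure ?_) isClosed_closure)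
  refine Metric.totallyBounded_iff.2 fun ε hε => ?_
  obtain ⟨t, hball, hfin, hcover⟩ := Set.exists_subset_image_finite_and.1
    (Metric.finite_approx_of_totallyBounded htot (ε ^ 2 / 2) (by positivity))
  refine ⟨_, hfin.image (star T : H →L[ℂ] H), ?_⟩
  rintro _ ⟨x, hx, rfl⟩
  obtain ⟨_, ⟨y, hy, rfl⟩, hxy⟩ := Set.mem_iUnion₂.1 (hcover ⟨x, hx, rfl⟩)
  refine Set.mem_iUnion₂.2 ⟨_, ⟨y, hy, rfl⟩, ?_⟩
  have hnorm : ‖x - y‖ < 2 := by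
    have hx' := mem_ball_zero_iff.1 hx
    have hy' := mem_ball_zero_iff.1 (hball hy)
    linarith [norm_sub_le x y]
  rw [mem_ball_iff_norm, ← map_sub] at hxy
  change dist (star T x) (star T y) < ε
  rw [dist_eq_norm, ← map_sub]
  refine lt_of_pow_lt_pow_left₀ 2 hε.le ?_
  calc ‖star T (x - y)‖ ^ 2 ≤ ‖(T * star T) (x - y)‖ * ‖x - y‖ := norm_star_apply_sq_le T _
    _ ≤ ‖(T * star T) (x - y)‖ * 2 := by gcongr
    _ < ε ^ 2 := by linarith

end Operators

/-! ### Operator inequalities and representations of the enveloping algebra -/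

theorem nonneg_of_map_nonneg {D₁ D₂ : Type*}
    [NonUnitalCStarAlgebra D₁] [PartialOrder D₁] [StarOrderedRing D₁]
    [NonUnitalCStarAlgebra D₂] [PartialOrder D₂] [StarOrderedRing D₂]
    {φ : D₁ →⋆ₙₐ[ℂ] D₂} (hφ : Function.Injective φ) {d : D₁} (hd : 0 ≤ φ d) : 0 ≤ d := by
  have hsa : IsSelfAdjoint d := hφ ((map_star φ d).trans hd.isSelfAdjoint)
  refine (CFC.negPart_eq_zero_iff d).1 (hφ ?_)
  rw [map_zero, ← (CFC.negPart_eq_zero_iff (φ d)).2 hd]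
  exact NonUnitalStarAlgHomClass.map_cfcₙ φ _ d

section Domination

variable {H : Type*} [NormedAddCommGroup H] [InnerProductSpace ℂ H] [CompleteSpace H]
  {H' : Type*} [NormedAddCommGroup H'] [InnerProductSpace ℂ H'] [CompleteSpace H']
  {D : Type*} [NonUnitalCStarAlgebra D]

/-- The factorization `φ b = V * φ a` gives `b* b ≤ ‖V‖² a* a` in `D`, an inequality which, unlike
`V` itself, can be carried over to `σ`. -/
theorem norm_apply_le_of_map_eq_mul {φ : D →⋆ₙₐ[ℂ] (H →L[ℂ] H)} (hφ : Function.Injective φ)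
    (σ : D →⋆ₙₐ[ℂ] (H' →L[ℂ] H')) {a b : D} {V : H →L[ℂ] H} (hV : φ b = V * φ a) (ξ : H') :
    ‖σ b ξ‖ ≤ ‖V‖ * ‖σ a ξ‖ := by
  let _ := CStarAlgebra.spectralOrder D
  have _ := CStarAlgebra.spectralOrderedRing D
  have hbb : φ (star b * b) = star (φ a) * (star V * V) * φ a := by
    simp only [map_mul, map_star, hV, star_mul, mul_assoc]
  have hd : 0 ≤ (‖star V * V‖ : ℂ) • (star a * a) - star b * b := by
    refine nonneg_of_map_nonneg hφ ?_
    rw [map_sub, map_smul, hbb, map_mul, map_star, sub_nonneg, Complex.coe_smul]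
    exact CStarAlgebra.star_left_conjugate_le_norm_smul
  have hsq (c : D) : inner ℂ (σ (star c * c) ξ) ξ = (‖σ c ξ‖ : ℂ) ^ 2 := by
    rw [map_mul, map_star, mul_apply_eq_comp, ContinuousLinearMap.star_eq_adjoint,
      ContinuousLinearMap.adjoint_inner_left, inner_self_eq_norm_sq_to_K]
    rfl
  have hσ : 0 ≤ ‖V‖ ^ 2 * ‖σ a ξ‖ ^ 2 - ‖σ b ξ‖ ^ 2 := by
    have h := ((ContinuousLinearMap.nonneg_iff_isPositive _).1
      (map_nonneg σ hd)).re_inner_nonneg_left ξ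
    rw [map_sub, map_smul, sub_apply, _root_.smul_apply, inner_sub_left, inner_smul_left, hsq, hsq,
      CStarRing.norm_star_mul_self, Complex.conj_ofReal] at h
    simpa [← Complex.ofReal_pow, ← Complex.ofReal_mul, ← pow_two] using h
  refine le_of_sq_le_sq ?_ (by positivity)
  rw [mul_pow]
  exact sub_nonneg.1 hσ

end Domination

section EvalRep

variable {𝔅 : Type u} [NonUnitalNormedRing 𝔅] [StarRing 𝔅] [NormedStarGroup 𝔅] [CompleteSpace 𝔅]
  [NormedSpace ℂ 𝔅] [IsScalarTower ℂ 𝔅 𝔅] [SMulCommClass ℂ 𝔅 𝔅] [StarModule ℂ 𝔅]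

/-- The extension of a representation to the enveloping `C^*`-algebra. -/
def evalRep (π : HilbertRep 𝔅) : Enveloping 𝔅 →⋆ₙₐ[ℂ] (π.H →L[ℂ] π.H) where
  toFun e := e.1.1 π
  map_smul' _ _ := rfl
  map_zero' := rfl
  map_add' _ _ := rfl
  map_mul' _ _ := rfl
  map_star' _ := rfl

theorem evalRep_toEnveloping (π : HilbertRep 𝔅) (b : 𝔅) :
    evalRep π (toEnveloping 𝔅 b) = π.toHom b := rfl

theorem denseRange_toEnveloping : DenseRange (toEnveloping 𝔅) := by
  refine Subtype.dense_iff.2 fun e he => closure_mono ?_ he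
  rintro _ ⟨b, rfl⟩
  exact ⟨_, ⟨b, rfl⟩, rfl⟩

end EvalRep

/-! ### Lifting parametrices to the Banach algebra -/

theorem toEnveloping_one_mul {𝔅 : Type u} [NormedRing 𝔅] [StarRing 𝔅] [NormedStarGroup 𝔅]
    [CompleteSpace 𝔅] [NormedAlgebra ℂ 𝔅] [StarModule ℂ 𝔅] (e : Enveloping 𝔅) :
    toEnveloping 𝔅 1 * e = e := by
  refine denseRange_toEnveloping.induction_on e
    (isClosed_eq (continuous_const.mul continuous_id) continuous_id) fun b => ?_
  rw [← map_mul, one_mul]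

section Representation

variable {𝔅 : Type u} [NormedRing 𝔅] [StarRing 𝔅] [NormedStarGroup 𝔅] [CompleteSpace 𝔅]
  [NormedAlgebra ℂ 𝔅] [StarModule ℂ 𝔅]
  {H : Type w} [NormedAddCommGroup H] [InnerProductSpace ℂ H] [CompleteSpace H]
  (Pi : Enveloping 𝔅 →⋆ₙₐ[ℂ] (H →L[ℂ] H))

/-- The elements of a Banach `*`-algebra that are represented by compact operators. -/
def compactIdeal : ClosedStarIdeal 𝔅 where
  toIdeal :=
    { carrier := {b | IsCompactOperator (Pi (toEnveloping 𝔅 b))}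
      zero_mem' := by
        rw [Set.mem_ofPred_eq, map_zero, map_zero]
        exact isCompactOperator_zero
      add_mem' := fun {a b} ha hb => by
        rw [Set.mem_ofPred_eq, map_add, map_add]
        exact ha.add hb
      smul_mem' := fun a b hb => by
        rw [Set.mem_ofPred_eq, smul_eq_mul, map_mul, map_mul]
        exact IsCompactOperator.clm_comp hb (Pi (toEnveloping 𝔅 a)) }
  isTwoSided := ⟨fun {b} a hb => by
    change IsCompactOperator (Pi (toEnveloping 𝔅 (b * a)))
    rw [map_mul, map_mul]
    exact IsCompactOperator.comp_clm hb (Pi (toEnveloping 𝔅 a))⟩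
  isClosed := isClosed_setOfPred_isCompactOperator.preimage
    ((continuous_hom Pi).comp (continuous_hom (toEnveloping 𝔅)))
  star_mem b hb := by
    change IsCompactOperator (Pi (toEnveloping 𝔅 (star b)))
    rw [map_star, map_star]
    exact isCompactOperator_star hb

theorem mem_compactIdeal {b : 𝔅} :
    b ∈ (compactIdeal Pi).toIdeal ↔ IsCompactOperator (Pi (toEnveloping 𝔅 b)) := Iff.rfl

variable {Pi} (hPi : Function.Injective Pi)
  (hdense : {T : H →L[ℂ] H | IsCompactOperator T} ⊆
    closure ({T | IsCompactOperator T} ∩ NonUnitalStarAlgHom.range (Pi.comp (toEnveloping 𝔅))))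

include hPi hdense

theorem exists_apply_eq_of_isCompactOperator {K : H →L[ℂ] H} (hK : IsCompactOperator K) :
    ∃ e, Pi e = K := by
  refine (NonUnitalStarAlgHom.isometry Pi hPi).isClosedEmbedding.isClosed_range.closure_subset_iff.2
    ?_ (hdense hK)
  rintro _ ⟨-, b, rfl⟩
  exact ⟨toEnveloping 𝔅 b, rfl⟩

theorem apply_toEnveloping_one : Pi (toEnveloping 𝔅 1) = 1 := by
  refine eq_one_of_mul_compact_eq fun K hK => ?_
  obtain ⟨e, rfl⟩ := exists_apply_eq_of_isCompactOperator hPi hdense hK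
  rw [← map_mul, toEnveloping_one_mul]

theorem evalRep_eq_zero_of_isCompactOperator {π : HilbertRep 𝔅}
    (hπ : ∀ b ∈ (compactIdeal Pi).toIdeal, π.toHom b = 0) {e : Enveloping 𝔅}
    (he : IsCompactOperator (Pi e)) : evalRep π e = 0 := by
  have hmem : e ∈ closure (toEnveloping 𝔅 '' (compactIdeal Pi).toIdeal) := by
    have hPi_ind := (NonUnitalStarAlgHom.isometry Pi hPi).isEmbedding.isInducing
    rw [hPi_ind.closure_eq_preimage_closure_image]
    refine closure_mono ?_ (hdense he)
    rintro _ ⟨hb, b, rfl⟩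
    exact ⟨_, ⟨b, hb, rfl⟩, rfl⟩
  refine closure_minimal ?_ (isClosed_eq (continuous_hom (evalRep π)) continuous_const) hmem
  rintro _ ⟨b, hb, rfl⟩
  exact hπ b hb

theorem exists_left_inverse_mod_compact (hsymm : IsSymmetric (compactIdeal Pi).Quot)
    {b : 𝔅} {V K : H →L[ℂ] H} (hK : IsCompactOperator K)
    (hV : V * Pi (toEnveloping 𝔅 b) = 1 + K) :
    ∃ c, IsCompactOperator (Pi (toEnveloping 𝔅 (c * b - 1))) := by
  by_contra! hcon
  obtain ⟨π, ξ, hξ, hone, hzero, hker⟩ := (compactIdeal Pi).exists_hilbertRep hsymm hcon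
  obtain ⟨k, rfl⟩ := exists_apply_eq_of_isCompactOperator hPi hdense hK
  have hfactor : Pi (toEnveloping 𝔅 1 + k) = V * Pi (toEnveloping 𝔅 b) := by
    rw [hV, map_add, apply_toEnveloping_one hPi hdense]
  have hbound := norm_apply_le_of_map_eq_mul hPi (evalRep π) hfactor ξ
  rw [map_add, evalRep_eq_zero_of_isCompactOperator hPi hdense hker hK, add_zero,
    evalRep_toEnveloping, evalRep_toEnveloping, hone, hzero, norm_zero, mul_zero] at hbound
  exact hξ (norm_le_zero_iff.1 hbound)

theorem fredholmInverseClosed_range (hsymm : IsSymmetric (compactIdeal Pi).Quot) :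
    FredholmInverseClosed (NonUnitalStarAlgHom.range (Pi.comp (toEnveloping 𝔅))) := by
  rintro _ ⟨b, rfl⟩ hT
  obtain ⟨V, K, L, hK, hL, hVT, hTV⟩ := exists_parametrix hT
  obtain ⟨c, hc⟩ := exists_left_inverse_mod_compact hPi hdense hsymm hK hVT
  have hcb : Pi (toEnveloping 𝔅 c) * Pi (toEnveloping 𝔅 b) =
      1 + Pi (toEnveloping 𝔅 (c * b - 1)) := by
    rw [map_sub, map_sub, map_mul, map_mul, apply_toEnveloping_one hPi hdense]
    abel
  obtain ⟨L', hL', hbc⟩ := exists_mul_eq_one_add_compact hc hL hcb hTV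
  exact ⟨_, ⟨c, rfl⟩, _, L', hc, hL', hcb, hbc⟩

end Representation

theorem TwistedAction.compact_subset_closure_range {G : Type u} [Group G]
    {A : Type v} [CStarAlgebra A] {S : TwistedAction G A} {J : Ideal A}
    {H : Type w} [NormedAddCommGroup H] [InnerProductSpace ℂ H] [CompleteSpace H]
    {Pi : S.CrossedProduct →⋆ₙₐ[ℂ] (H →L[ℂ] H)}
    (hPiJ : Pi '' S.crossedIdeal J = {T : H →L[ℂ] H | IsCompactOperator T}) :
    {T : H →L[ℂ] H | IsCompactOperator T} ⊆ closure ({T | IsCompactOperator T} ∩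
      NonUnitalStarAlgHom.range (Pi.comp S.toCrossedProduct)) := by
  rw [← hPiJ]
  refine (image_closure_subset_closure_image (continuous_hom Pi)).trans (closure_mono ?_)
  rintro _ ⟨_, ⟨f, hf, rfl⟩, rfl⟩
  exact ⟨⟨_, subset_closure ⟨f, hf, rfl⟩, rfl⟩, f, rfl⟩

end TwistedCrossed

end

theorem mainTheorem4_general {G : Type u} [Group G]
    (hG : TwistedCrossed.RigidlySymmetric.{u, max u v} G)
    {A : Type v} [CStarAlgebra A] (S : TwistedCrossed.TwistedAction G A)
    {H : Type w} [NormedAddCommGroup H] [InnerProductSpace ℂ H] [CompleteSpace H]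
    (Pi : S.CrossedProduct →⋆ₙₐ[ℂ] (H →L[ℂ] H)) (hPi : Function.Injective Pi)
    (hdense : {T : H →L[ℂ] H | IsCompactOperator T} ⊆ closure ({T | IsCompactOperator T} ∩
      NonUnitalStarAlgHom.range (Pi.comp S.toCrossedProduct))) :
    TwistedCrossed.FredholmInverseClosed
      (NonUnitalStarAlgHom.range (Pi.comp S.toCrossedProduct)) := by
  refine TwistedCrossed.fredholmInverseClosed_range hPi hdense
    (TwistedCrossed.TwistedAction.isSymmetric_quot hG _ fun f hf => ?_)
  rw [TwistedCrossed.mem_compactIdeal, hf, map_zero]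
  exact isCompactOperator_zero

theorem mainTheorem4 {G : Type u} [Group G]
    (hG : TwistedCrossed.RigidlySymmetric.{u, max u v} G)
    {A : Type v} [CStarAlgebra A] (S : TwistedCrossed.TwistedAction G A)
    (J : Ideal A) [J.IsTwoSided] (hJ_closed : IsClosed (J : Set A))
    (hJ_star : ∀ a ∈ J, star a ∈ J) (hJ_inv : ∀ x : G, ∀ a ∈ J, S.α x a ∈ J)
    {H : Type w} [NormedAddCommGroup H] [InnerProductSpace ℂ H] [CompleteSpace H]
    (Pi : S.CrossedProduct →⋆ₙₐ[ℂ] (H →L[ℂ] H)) (hPi : Function.Injective Pi)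
    (hPiJ : Pi '' S.crossedIdeal J = {T : H →L[ℂ] H | IsCompactOperator T}) :
    TwistedCrossed.FredholmInverseClosed
      (NonUnitalStarAlgHom.range (Pi.comp S.toCrossedProduct)) :=
  mainTheorem4_general hG S Pi hPi (TwistedCrossed.TwistedAction.compact_subset_closure_range hPiJ)
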